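/- **Setting.** Let $\Lambda\subset\mathbb{R}^k$ be compact and let $\mu$ be a Borel probability measure on $\Lambda$. For each $\lambda\in\Lambda$ let $\mathbb{I}_\lambda=\{f_\lambda^1,\dots,f_\lambda^{N(\lambda)}\}$ be a finite family of maps $\mathbb{R}^d\to\mathbb{R}^d$, depending measurably on $\lambda$, with $N(\lambda)\le\mathscr{N}$ for a fixed $\mathscr{N}\in\mathbb{N}$. We assume that $N(\lambda)=0$ exactly when $\lambda=0$, and that $0$ is isolated in $\Lambda$ if $0\in\Lambda$. The pair $(\mathbb{L},\mu)$, $\mathbb{L}=\{\mathbb{I}_\lambda\}_{\lambda\in\Lambda}$, is a random iterated function system (RIFS). Let $\mathfrak{T}$ be the rooted $\mathscr{N}$-ary tree, whose vertices are the finite words $v=(v_1,\dots,v_n)$ with $v_i\in\{1,\dots,\mathscr{N}\}$, and let $\mathbb{P}=\mu^{\mathfrak{T}}$ be the product measure on the space $\mathcal{T}=\Lambda^{\mathfrak{T}}$ of labellings (code trees) $\tau$. For a vertex $v$ at level $n$ such that $v_{j}\le N(\tau(v_1,\dots,v_{j-1}))$ for $1\le j\le n$, put $f_{\tau,v}=f_{\tau(\cdot)}^{v_1}\circ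 f_{\tau(v_1)}^{v_2}\circ\dots\circ f_{\tau(v_1,\dots,v_{n-1})}^{v_n}$; call such $v$ admissible for $\tau$. Let $\Delta\subset\mathbb{R}^d$ be a non-empty compact set with $f_\lambda^i(\Delta)\subseteq\Delta$ for all $\lambda\in\Lambda$ and $1\le i\le N(\lambda)$ (such a set is assumed to exist). The random recursive set is $$F_\tau=\bigcap_{n=1}^\infty\ \bigcup_{v\text{ admissible for }\tau,\ |v|=n} f_{\tau,v}(\Delta),$$ which does not depend on the choice of $\Delta$ and may be empty. **Dimensions.** Let $|F|$ be the diameter of $F$, let $N_r(F)$ be the minimal number of sets of diameter at most $r$ needed to cover $F$, and let $N_{r,R}(F)=\max_{x\in F}N_r(B(x,R)\cap F)$, where $B(x,R)$ is the open ball. For $\delta>0$ let $$h(\delta,F)=\inf\{\alpha\ge0 : \exists C>0\ \forall\, r,R>0 \text{ with } r\le R^{1+\delta}\le|F|:\ N_{r,R}(F)\le C(R/r)^\alpha\}.$$ The quasi-Assouad dimension is $\dim_{qA}F=\lim_{\delta\to0+}h(\delta,F)$, the box dimension is $\dim_BF=\lim_{r\to0+}\log N_r(F)/\log(1/r)$ when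 these limits exist, and $\dim_H$ is the Hausdorff dimension. All of these dimensions of $\varnothing$ are $0$. **Theorem.** Let $(\mathbb{L},\mu)$ be a RIFS such that 1. (uniform similarities) there are $0<c_{\min}\le c_{\max}<1$ such that every $f_\lambda^i$ satisfies $\|f_\lambda^i(x)-f_\lambda^i(y)\|=c_\lambda^i\|x-y\|$ for all $x,y\in\mathbb{R}^d$, with $c_{\min}\le c_\lambda^i\le c_{\max}$; 2. (non-extinguishing) $\int_\Lambda N(\lambda)\,d\mu(\lambda)>1$; 3. (uniform open set condition) there is a non-empty open set $\mathcal{O}\subset\mathbb{R}^d$ such that $f_\lambda^i(\mathcal{O})\subseteq\mathcal{O}$ for all $\lambda\in\Lambda$ and $1\le i\le N(\lambda)$, and $f_\lambda^i(\mathcal{O})\cap f_\lambda^j(\mathcal{O})=\varnothing$ for all $\lambda\in\Lambda$ and $i\ne j$. Then, for $\mathbb{P}$-almost every $\tau\in\mathcal{T}$, the limits that define $\dim_{qA}F_\tau$ and $\dim_BF_\tau$ exist and $$\dim_{qA}F_\tau=\dim_HF_\tau=\dim_BF_\tau .$$ Moreover, there is a constant $s\ge0$ such that this common value equals $s$ for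 $\mathbb{P}$-almost every $\tau$ with $F_\tau\neq\varnothing$. -/

import Mathlib

open MeasureTheory Set Filter Topology
open scoped ENNReal NNReal

noncomputable section

/-! ### Covering numbers and dimensions of sets in a metric space -/

/-- `N_r(F)`: the minimal number of sets of diameter (at most) `r` needed to cover `F`. -/
def coverNumber {X : Type*} [PseudoMetricSpace X] (r : ℝ) (F : Set X) : ℕ∞ :=
  ⨅ (𝒰 : Set (Set X)) (_ : (∀ U ∈ 𝒰, Metric.ediam U ≤ ENNReal.ofReal r) ∧ F ⊆ ⋃₀ 𝒰), 𝒰.encard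

/-- `N_{r,R}(F) = max_{x ∈ F} N_r(B(x,R) ∩ F)`. -/
def localCoverNumber {X : Type*} [PseudoMetricSpace X] (r R : ℝ) (F : Set X) : ℕ∞ :=
  ⨆ x ∈ F, coverNumber r (Metric.ball x R ∩ F)

/-- `h(δ, F)`: the infimum of the exponents `α ≥ 0` for which there is `C > 0` with
`N_{r,R}(F) ≤ C (R / r) ^ α` for all `0 < r ≤ R ^ (1 + δ) ≤ |F|`. -/
def gapAssouadDim {X : Type*} [PseudoMetricSpace X] (δ : ℝ) (F : Set X) : ℝ≥0∞ :=
  ⨅ (α : ℝ≥0) (_ : ∃ C : ℝ, 0 < C ∧ ∀ r R : ℝ, 0 < r → 0 < R → r ≤ R ^ (1 + δ) →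
      R ^ (1 + δ) ≤ Metric.diam F →
      (localCoverNumber r R F : ℝ≥0∞) ≤ ENNReal.ofReal (C * (R / r) ^ (α : ℝ))), (α : ℝ≥0∞)

/-- The number `s` is the quasi-Assouad dimension of `F`: the limit `lim_{δ → 0+} h(δ, F)`
exists and equals `s`. -/
def HasQuasiAssouadDim {X : Type*} [PseudoMetricSpace X] (F : Set X) (s : ℝ≥0∞) : Prop :=
  Tendsto (fun δ : ℝ => gapAssouadDim δ F) (𝓝[>] 0) (𝓝 s)

/-- `log N_r(F) / log (1 / r)` for a totally bounded set `F` and `0 < r < 1`; the value is `0`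
for `F = ∅`. -/
def boxRatio {X : Type*} [PseudoMetricSpace X] (r : ℝ) (F : Set X) : ℝ≥0∞ :=
  ENNReal.ofReal (Real.log ((coverNumber r F).toNat : ℝ) / Real.log (1 / r))

/-- The number `s` is the box-counting dimension of the totally bounded set `F`: the limit
`lim_{r → 0+} log N_r(F) / log (1 / r)` exists and equals `s`. -/
def HasBoxDim {X : Type*} [PseudoMetricSpace X] (F : Set X) (s : ℝ≥0∞) : Prop :=
  Tendsto (fun r : ℝ => boxRatio r F) (𝓝[>] 0) (𝓝 s)

/-! ### Random iterated function systems -/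

/-- A random iterated function system `(𝕃, μ)` on `ℝ^d` with index set `Λ ⊆ ℝ^k`. -/
structure RIFS (k d : ℕ) where
  /-- the compact index set -/
  Λ : Set (EuclideanSpace ℝ (Fin k))
  isCompact_Λ : IsCompact Λ
  /-- the point `0`, if it belongs to `Λ`, is isolated in `Λ` -/
  isolated_zero : (0 : EuclideanSpace ℝ (Fin k)) ∈ Λ →
    (0 : EuclideanSpace ℝ (Fin k)) ∉ closure (Λ \ {0})
  /-- the distribution of the labels -/
  μ : Measure Λ
  isProbabilityMeasure_μ : IsProbabilityMeasure μ
  /-- a common bound for the numbers of maps -/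
  bound : ℕ
  /-- the number of maps of the system with index `l` -/
  N : Λ → ℕ
  N_le : ∀ l, N l ≤ bound
  /-- the system with index `l` is empty exactly for `l = 0` -/
  N_eq_zero_iff : ∀ l, N l = 0 ↔ (l : EuclideanSpace ℝ (Fin k)) = 0
  /-- the maps of the system with index `l` -/
  f : (l : Λ) → Fin (N l) → EuclideanSpace ℝ (Fin d) → EuclideanSpace ℝ (Fin d)
  measurable_N : Measurable N
  measurable_f : ∀ (i : ℕ) (x : EuclideanSpace ℝ (Fin d)),
    Measurable (fun l : {l : Λ // i < N l} => f l.1 ⟨i, l.2⟩ x)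

namespace RIFS

variable {k d : ℕ} (S : RIFS k d)

instance : IsProbabilityMeasure S.μ := S.isProbabilityMeasure_μ

/-- All maps are similarities, with contraction ratios uniformly bounded away from `0` and `1`. -/
def UniformSimilarities : Prop :=
  ∃ cmin cmax : ℝ, 0 < cmin ∧ cmin ≤ cmax ∧ cmax < 1 ∧
    ∀ (l : S.Λ) (i : Fin (S.N l)), ∃ c : ℝ, cmin ≤ c ∧ c ≤ cmax ∧
      ∀ x y, ‖S.f l i x - S.f l i y‖ = c * ‖x - y‖

/-- The expected number of maps is larger than `1`. -/
def NonExtinguishing : Prop :=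
  1 < ∫ l, (S.N l : ℝ) ∂S.μ

/-- The uniform open set condition. -/
def UniformOpenSetCondition : Prop :=
  ∃ O : Set (EuclideanSpace ℝ (Fin d)), IsOpen O ∧ O.Nonempty ∧
    (∀ (l : S.Λ) (i : Fin (S.N l)), S.f l i '' O ⊆ O) ∧
    ∀ (l : S.Λ) (i j : Fin (S.N l)), (S.f l i '' O ∩ S.f l j '' O).Nonempty → i = j

/-- A vertex `(v₁, …, vₙ)` of the full tree in which every vertex has `bound` children. -/
abbrev Node : Type := List (Fin S.bound)

/-- A labelling of the full tree by elements of `Λ`. -/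
abbrev CodeTree : Type := S.Node → S.Λ

/-- The law of the labelling: the labels are independent with distribution `μ`. -/
def treeMeasure : Measure S.CodeTree :=
  Measure.infinitePi (fun _ : S.Node => S.μ)

/-- The letter `e_l^j`, which stands for the map `f_l^j`. -/
abbrev Letter : Type := Σ l : S.Λ, Fin (S.N l)

/-- A coding: a finite word of letters, or `none`, which is the letter `∅` that stands for
extinction. -/
abbrev Coding : Type := Option (List S.Letter)

/-- Concatenation `e ⊙ e'`, with `none` as a multiplicative zero. -/
def codingMul (e e' : S.Coding) : S.Coding :=
  Option.map₂ (fun w w' => w ++ w') e e'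

/-- The one-letter coding `e_l^j`, or `∅` if there is no `j`-th map. -/
def letterCoding (l : S.Λ) (j : Fin S.bound) : S.Coding :=
  if h : (j : ℕ) < S.N l then some [⟨l, ⟨j, h⟩⟩] else none

/-- The subtree `σ^v τ` that starts at the vertex `v`. -/
def subtree (v : S.Node) (τ : S.CodeTree) : S.CodeTree :=
  fun w => τ (v ++ w)

/-- The coding tree `T_τ`; see `codingTree_concat` for the recursion from a vertex to its
children. -/
def codingTree : S.CodeTree → S.Node → S.Coding
  | _, [] => some []
  | τ, j :: v => S.codingMul (S.letterCoding (τ []) j) (codingTree (S.subtree [j] τ) v)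

theorem codingTree_concat (τ : S.CodeTree) (v : S.Node) (j : Fin S.bound) :
    S.codingTree τ (v ++ [j]) = S.codingMul (S.codingTree τ v) (S.letterCoding (τ v) j) := by
  induction v generalizing τ with
  | nil =>
    cases h : S.letterCoding (τ []) j <;> simp [codingTree, codingMul, h]
  | cons i v ih =>
    have hs : S.subtree [i] τ v = τ (i :: v) := rfl
    simp only [List.cons_append, codingTree, ih, hs]
    cases S.letterCoding (τ []) i <;> cases S.codingTree (S.subtree [i] τ) v <;>
      cases S.letterCoding (τ (i :: v)) j <;> simp [codingMul]

/-- The surviving codings at the `n`-th level of the coding tree. -/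
def levelCodings (τ : S.CodeTree) (n : ℕ) : Set (List S.Letter) :=
  {e | ∃ v : S.Node, v.length = n ∧ S.codingTree τ v = some e}

/-- The composition `f_{e₁} ∘ ⋯ ∘ f_{eₙ}`. -/
def wordMap : List S.Letter → EuclideanSpace ℝ (Fin d) → EuclideanSpace ℝ (Fin d)
  | [] => id
  | e :: w => S.f e.1 e.2 ∘ wordMap w

/-- A non-empty compact set `Δ` that every map of the system maps into itself. -/
def IsInvariantCompact (Δ : Set (EuclideanSpace ℝ (Fin d))) : Prop :=
  IsCompact Δ ∧ Δ.Nonempty ∧ ∀ (l : S.Λ) (i : Fin (S.N l)), S.f l i '' Δ ⊆ Δ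

/-- The random recursive set `F_τ = ⋂_{n ≥ 1} ⋃_e f_{e₁} ∘ ⋯ ∘ f_{eₙ} (Δ)`, the union being over
the codings `e` at level `n`. It does not depend on the choice of the non-empty compact set `Δ`
with `f_l^i (Δ) ⊆ Δ`. -/
def randomRecursiveSet (Δ : Set (EuclideanSpace ℝ (Fin d))) (τ : S.CodeTree) :
    Set (EuclideanSpace ℝ (Fin d)) :=
  ⋂ (n : ℕ) (_ : 1 ≤ n), ⋃ e ∈ S.levelCodings τ n, S.wordMap e '' Δ

end RIFS

end

noncomputable section

/-! Write `m(t)` for the mean, over a random label `l`, of the sum of the `t`-th powers of the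
contraction ratios. For `t > 0` it is strictly decreasing, and the almost sure dimension is the
exponent `s` at which it passes the value `1` (`exists_criticalExponent`).

Upper bound, `t > s`. The branching process with weights `c l j ^ t` is subcritical, so the total
weight of a tree (`branchSum`) has an exponential moment. Summing these moments over all vertices
with a damping factor shows that almost surely the total weight of the subtree at `v` is at most
linear in the level of `v`, for all `v` at once (`ae_branchSum_descendantTree_le`). Total weight
controls covering numbers, because a cylinder of size about `ρ` has weight about `ρ ^ t`
(`coverNumber_levelSet_le`). By the open set condition a ball of radius `R` meets boundedly many
cylinders of size `R`, and these lie at level `O(log (1 / R))`. So `N_{r,R}` is at most a constant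
times `log (1 / R) * (R / r) ^ t` for small `R`. The gap `r ≤ R ^ (1 + δ)` lets an arbitrarily small
power of `R / r` absorb the logarithm, whence `h(δ, F) ≤ s` for every `δ > 0`. The same covering
bound at scale `1` controls the box dimension.

Lower bound, `t < s`. For a fixed tree, keep each edge independently with probability `c l j ^ t`.
The probability that almost every percolation is finite is a fixed point, smaller than `1`, of the
generating function of the number of children; so is the extinction probability of the tree. Such a
fixed point is unique, hence almost every surviving tree percolates with positive probability
(`ae_extinctionLimit_lt_one`). A cover of the limit set with small `t`-dimensional cost would give a
cut set of the tree whose weight is below that probability, and the union bound excludes this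
(`exists_ray_avoiding`). Hence the `t`-dimensional Hausdorff measure is positive
(`hausdorffMeasure_ne_zero`).

Since the Hausdorff dimension never exceeds `h(δ, F)` when the diameter is positive, all values
coincide with `s` on a nonempty limit set. -/

/-- The labelling of the subtree at the `j`-th child of the root. -/
def childTree {L : Type*} {B : ℕ} (j : Fin B) (τ : List (Fin B) → L) : List (Fin B) → L :=
  fun w => τ (j :: w)

/-- The tree with root label `l` and subtrees `σ j`. -/
def graftTree {L : Type*} {B : ℕ} (p : L × (Fin B → List (Fin B) → L)) : List (Fin B) → L
  | [] => p.1
  | j :: w => p.2 j w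

/-! ### The branching property of the law of a random tree -/

section Branching

variable {L : Type*} [MeasurableSpace L] {B : ℕ} (μ : Measure L) [IsProbabilityMeasure μ]

/-- The law of a tree with independent labels. -/
abbrev labelLaw (B : ℕ) : Measure (List (Fin B) → L) := Measure.infinitePi fun _ => μ

@[fun_prop]
theorem measurable_childTree (j : Fin B) :
    Measurable (childTree j : (List (Fin B) → L) → List (Fin B) → L) := by
  unfold childTree; fun_prop

theorem measurable_graftTree :
    Measurable (graftTree : L × (Fin B → List (Fin B) → L) → List (Fin B) → L) := by
  refine measurable_pi_iff.2 fun v => ?_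
  cases v with
  | nil => exact measurable_fst
  | cons j w =>
    change Measurable fun p : L × (Fin B → List (Fin B) → L) => p.2 j w
    fun_prop

/-- A product measure is determined by finite cylinders. Every nonempty word is uniquely of the form
`j :: w`, so a cylinder pulls back to a condition on the root times cylinders in the subtrees. -/
theorem measurePreserving_graftTree :
    MeasurePreserving graftTree (μ.prod (Measure.pi fun _ : Fin B => labelLaw μ B))
      (labelLaw μ B) := by
  refine ⟨measurable_graftTree, ?_⟩
  refine Measure.eq_infinitePi _ fun s t ht => ?_
  classical
  rw [Measure.map_apply measurable_graftTree
    (MeasurableSet.pi s.countable_toSet fun i _ => ht i)]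
  -- Extending by `univ` off `s` makes the root factor uniform, whether or not `[] ∈ s`; the added
  -- factors have measure `1`.
  set t' : List (Fin B) → Set L := fun v => if v ∈ s then t v else univ with ht'
  have ht'm : ∀ v, MeasurableSet (t' v) := fun v => by
    simp only [ht']; split_ifs; exacts [ht v, MeasurableSet.univ]
  let u : Fin B → Finset (List (Fin B)) := fun j =>
    s.preimage (fun w => j :: w) (List.cons_injective.injOn)
  have hpre : graftTree ⁻¹' (Set.pi (s : Set (List (Fin B))) t) =
      t' [] ×ˢ Set.pi univ fun j => Set.pi (u j : Set (List (Fin B))) fun w => t' (j :: w) := by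
    ext p
    simp only [mem_preimage, Set.mem_pi, Finset.mem_coe, mem_prod, mem_univ, true_imp_iff, u,
      Finset.mem_preimage, ht']
    constructor
    · intro h
      refine ⟨?_, fun j w hw => ?_⟩
      · split_ifs with h0
        · exact h [] h0
        · trivial
      · rw [if_pos hw]; exact h _ hw
    · rintro ⟨h0, h1⟩ v hv
      cases v with
      | nil => simpa [graftTree, hv] using h0
      | cons j w => simpa [graftTree, hv] using h1 j w hv
  rw [hpre, Measure.prod_prod, Measure.pi_pi]
  simp_rw [labelLaw, Measure.infinitePi_pi (fun _ : List (Fin B) => μ) (fun i _ => ht'm _)]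
  have hs : s ⊆ insert [] (Finset.univ.biUnion fun j => (u j).image fun w => j :: w) := by
    intro v hv
    cases v with
    | nil => simp
    | cons j w => simp [u, hv]
  have h1 : ∏ v ∈ s, μ (t v) =
      ∏ v ∈ insert [] (Finset.univ.biUnion fun j => (u j).image fun w => j :: w), μ (t' v) := by
    rw [← Finset.prod_subset hs]
    · exact Finset.prod_congr rfl fun v hv => by simp [ht', hv]
    · intro v _ hv; simp [ht', hv]
  rw [h1, Finset.prod_insert (by simp), Finset.prod_biUnion]
  · congr 1
    refine Finset.prod_congr rfl fun j _ => ?_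
    rw [Finset.prod_image (List.cons_injective.injOn)]
  · intro i _ j _ hij
    simp only [Function.onFun, Finset.disjoint_left, Finset.mem_image]
    rintro _ ⟨w, _, rfl⟩ ⟨w', _, h⟩
    simp only [List.cons.injEq] at h
    exact hij h.1.symm

/-- Conditionally on the label of the root, the subtrees of the children are independent copies of
the whole tree. -/
theorem lintegral_prod_childTree (g : Fin B → L × (List (Fin B) → L) → ℝ≥0∞)
    (hg : ∀ j, Measurable (g j)) :
    ∫⁻ τ, ∏ j, g j (τ [], childTree j τ) ∂labelLaw μ B =
      ∫⁻ l, ∏ j, ∫⁻ τ, g j (l, τ) ∂labelLaw μ B ∂μ := by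
  have hm : Measurable fun τ : List (Fin B) → L => ∏ j, g j (τ [], childTree j τ) := by
    fun_prop
  rw [← (measurePreserving_graftTree (B := B) μ).lintegral_comp hm]
  have hm2 : Measurable fun p : L × (Fin B → List (Fin B) → L) => ∏ j, g j (p.1, p.2 j) := by
    fun_prop
  calc _ = ∫⁻ p : L × (Fin B → List (Fin B) → L), ∏ j, g j (p.1, p.2 j)
        ∂(μ.prod (Measure.pi fun _ : Fin B => labelLaw μ B)) := rfl
    _ = _ := by
      rw [lintegral_prod _ hm2.aemeasurable]
      refine lintegral_congr fun l => ?_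
      have hi := ProbabilityTheory.iIndepFun_pi (μ := fun _ : Fin B => labelLaw μ B)
        (X := fun j σ => g j (l, σ))
        (fun j => ((hg j).comp measurable_prodMk_left).aemeasurable)
      have := ProbabilityTheory.lintegral_prod_eq_prod_lintegral_of_indepFun Finset.univ
        (fun j (σ : Fin B → List (Fin B) → L) => g j (l, σ j)) hi
        (fun j => by fun_prop)
      rw [this]
      refine Finset.prod_congr rfl fun j _ => ?_
      exact (measurePreserving_eval (fun _ : Fin B => labelLaw μ B) j).lintegral_comp
        ((hg j).comp measurable_prodMk_left)

theorem measurePreserving_childTree (j : Fin B) :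
    MeasurePreserving (childTree j) (labelLaw μ B) (labelLaw μ B) := by
  refine ⟨measurable_childTree j, Measure.ext_of_lintegral _ fun f hf => ?_⟩
  rw [lintegral_map hf (measurable_childTree j)]
  classical
  have := lintegral_prod_childTree μ (fun i p => if i = j then f p.2 else 1)
    (fun i => by split_ifs <;> fun_prop)
  have h2 : ∀ i : Fin B, (∫⁻ τ : List (Fin B) → L, (if i = j then f τ else 1) ∂labelLaw μ B) =
      if i = j then ∫⁻ τ, f τ ∂labelLaw μ B else 1 := fun i => by split_ifs <;> simp
  simpa [h2] using this

end Branching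

/-! ### Percolation on a fixed tree and its survival -/

section Extinction

variable {L : Type*} {B : ℕ}

/-- The probability that the root of `τ` is not joined to level `n` when the edge to the `j`-th
child of a vertex with label `l` is kept with probability `a l j`. -/
def extinctionProb (a : L → Fin B → ℝ) : ℕ → (List (Fin B) → L) → ℝ
  | 0, _ => 0
  | n + 1, τ => ∏ j, (1 - a (τ []) j * (1 - extinctionProb a n (childTree j τ)))

/-- The probability that the percolation cluster of the root is finite. -/
def extinctionLimit (a : L → Fin B → ℝ) (τ : List (Fin B) → L) : ℝ :=
  ⨆ n, extinctionProb a n τ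

variable {a : L → Fin B → ℝ}

theorem extinctionProb_mem (ha : ∀ l j, a l j ∈ Icc (0 : ℝ) 1) (n : ℕ)
    (τ : List (Fin B) → L) : extinctionProb a n τ ∈ Icc (0 : ℝ) 1 := by
  induction n generalizing τ with
  | zero => simp [extinctionProb]
  | succ n ih =>
    have h : ∀ j, 1 - a (τ []) j * (1 - extinctionProb a n (childTree j τ)) ∈ Icc (0 : ℝ) 1 := by
      intro j
      obtain ⟨h1, h2⟩ := ha (τ []) j
      obtain ⟨h3, h4⟩ := ih (childTree j τ)
      constructor <;> nlinarith
    exact ⟨Finset.prod_nonneg fun j _ => (h j).1, Finset.prod_le_one (fun j _ => (h j).1)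
      fun j _ => (h j).2⟩

theorem extinctionProb_le_succ (ha : ∀ l j, a l j ∈ Icc (0 : ℝ) 1) (n : ℕ)
    (τ : List (Fin B) → L) : extinctionProb a n τ ≤ extinctionProb a (n + 1) τ := by
  induction n generalizing τ with
  | zero => exact (extinctionProb_mem ha 1 τ).1
  | succ n ih =>
    refine Finset.prod_le_prod (fun j _ => ?_) fun j _ => ?_
    · obtain ⟨h1, h2⟩ := ha (τ []) j
      obtain ⟨h3, h4⟩ := extinctionProb_mem ha n (childTree j τ)
      nlinarith
    · have := mul_le_mul_of_nonneg_left (ih (childTree j τ)) (ha (τ []) j).1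
      linarith

theorem extinctionProb_antitone {b : L → Fin B → ℝ} (ha : ∀ l j, a l j ∈ Icc (0 : ℝ) 1)
    (hb : ∀ l j, b l j ∈ Icc (0 : ℝ) 1) (hab : ∀ l j, a l j ≤ b l j) (n : ℕ)
    (τ : List (Fin B) → L) : extinctionProb b n τ ≤ extinctionProb a n τ := by
  induction n generalizing τ with
  | zero => exact le_rfl
  | succ n ih =>
    refine Finset.prod_le_prod (fun j _ => ?_) fun j _ => ?_
    · obtain ⟨h1, h2⟩ := hb (τ []) j
      obtain ⟨h3, h4⟩ := extinctionProb_mem hb n (childTree j τ)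
      nlinarith
    · obtain ⟨h3, h4⟩ := extinctionProb_mem ha n (childTree j τ)
      have := ih (childTree j τ)
      have := mul_le_mul (hab (τ []) j) (sub_le_sub_left this 1) (by linarith) (hb (τ []) j).1
      linarith

theorem bddAbove_extinctionProb (ha : ∀ l j, a l j ∈ Icc (0 : ℝ) 1) (τ : List (Fin B) → L) :
    BddAbove (range fun n => extinctionProb a n τ) :=
  ⟨1, by rintro _ ⟨n, rfl⟩; exact (extinctionProb_mem ha n τ).2⟩

theorem tendsto_extinctionProb (ha : ∀ l j, a l j ∈ Icc (0 : ℝ) 1) (τ : List (Fin B) → L) :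
    Tendsto (fun n => extinctionProb a n τ) atTop (𝓝 (extinctionLimit a τ)) :=
  tendsto_atTop_ciSup (monotone_nat_of_le_succ fun n => extinctionProb_le_succ ha n τ)
    (bddAbove_extinctionProb ha τ)

theorem extinctionLimit_mem (ha : ∀ l j, a l j ∈ Icc (0 : ℝ) 1) (τ : List (Fin B) → L) :
    extinctionLimit a τ ∈ Icc (0 : ℝ) 1 :=
  isClosed_Icc.mem_of_tendsto (tendsto_extinctionProb ha τ)
    (Eventually.of_forall fun n => extinctionProb_mem ha n τ)

theorem extinctionLimit_eq (ha : ∀ l j, a l j ∈ Icc (0 : ℝ) 1) (τ : List (Fin B) → L) :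
    extinctionLimit a τ = ∏ j, (1 - a (τ []) j * (1 - extinctionLimit a (childTree j τ))) := by
  refine tendsto_nhds_unique ((tendsto_extinctionProb ha τ).comp (tendsto_add_atTop_nat 1)) ?_
  exact tendsto_finsetProd _ fun j _ =>
    ((tendsto_extinctionProb ha _).const_sub 1).const_mul _ |>.const_sub 1

/-- A product of numbers in `[0, 1]` is `1` only if every factor is. Hence almost sure finiteness is
inherited by the children, and only the positivity of the weights at the root matters. -/
theorem extinctionLimit_eq_one_iff (ha : ∀ l j, a l j ∈ Icc (0 : ℝ) 1) (τ : List (Fin B) → L) :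
    extinctionLimit a τ = 1 ↔ ∀ j, 0 < a (τ []) j → extinctionLimit a (childTree j τ) = 1 := by
  have h : ∀ j, 0 ≤ 1 - a (τ []) j * (1 - extinctionLimit a (childTree j τ)) ∧
      1 - a (τ []) j * (1 - extinctionLimit a (childTree j τ)) ≤ 1 := by
    intro j
    obtain ⟨h1, h2⟩ := ha (τ []) j
    obtain ⟨h3, h4⟩ := extinctionLimit_mem ha (childTree j τ)
    constructor <;> nlinarith
  rw [extinctionLimit_eq ha τ]
  constructor
  · intro h1 j hj
    by_contra hne
    have hlt : 1 - a (τ []) j * (1 - extinctionLimit a (childTree j τ)) < 1 := by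
      have := lt_of_le_of_ne (extinctionLimit_mem ha (childTree j τ)).2 hne
      nlinarith
    rw [← Finset.mul_prod_erase _ _ (Finset.mem_univ j)] at h1
    have h2 : ∏ i ∈ Finset.univ.erase j,
        (1 - a (τ []) i * (1 - extinctionLimit a (childTree i τ))) ≤ 1 :=
      Finset.prod_le_one (fun j _ => (h j).1) fun j _ => (h j).2
    nlinarith [(h j).1]
  · intro h1
    refine Finset.prod_eq_one fun j _ => ?_
    rcases (ha (τ []) j).1.eq_or_lt with h0 | h0
    · simp [← h0]
    · simp [h1 j h0]

/-- The product is at most `exp (-X) ≤ 1 / (1 + X)`, and `(1 + X) * (1 - X + X ^ 2) = 1 + X ^ 3 ≥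
1`. The quadratic error loses to the linear term when the `x i` are small. -/
theorem prod_one_sub_le {ι : Type*} (s : Finset ι) (x : ι → ℝ) (hx : ∀ i ∈ s, x i ∈ Icc (0 : ℝ) 1) :
    ∏ i ∈ s, (1 - x i) ≤ 1 - ∑ i ∈ s, x i + (∑ i ∈ s, x i) ^ 2 := by
  set X := ∑ i ∈ s, x i
  have hX : 0 ≤ X := Finset.sum_nonneg fun i hi => (hx i hi).1
  have h1 : ∏ i ∈ s, (1 - x i) ≤ Real.exp (-X) := by
    rw [← Finset.sum_neg_distrib, Real.exp_sum]
    exact Finset.prod_le_prod (fun i hi => by linarith [(hx i hi).2])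
      fun i _ => Real.one_sub_le_exp_neg _
  have h2 : Real.exp (-X) ≤ (1 + X)⁻¹ := by
    rw [Real.exp_neg]
    exact inv_anti₀ (by linarith) (by linarith [Real.add_one_le_exp X])
  have h3 : (1 + X)⁻¹ ≤ 1 - X + X ^ 2 := by
    rw [inv_le_iff_one_le_mul₀ (by linarith)]
    nlinarith [pow_nonneg hX 3]
  linarith

/-- The generating function of an integer-valued random variable with mean larger than `1` has at
most one fixed point in `[0, 1)`. -/
theorem generatingFunction_fixedPoint_unique [MeasurableSpace L] (μ : Measure L)
    [IsProbabilityMeasure μ] {n : L → ℕ} (hn : Measurable n) (hB : ∀ l, n l ≤ B)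
    (hmean : 1 < ∫ l, (n l : ℝ) ∂μ) {p q : ℝ} (hp : 0 ≤ p) (hq : q < 1)
    (hpf : ∫ l, p ^ n l ∂μ = p) (hqf : ∫ l, q ^ n l ∂μ = q) (hpq : p ≤ q) : p = q := by
  by_contra hne
  have hlt : p < q := lt_of_le_of_ne hpq hne
  have hint : ∀ x : ℝ, 0 ≤ x → x ≤ 1 → Integrable (fun l => x ^ n l) μ := by
    intro x h0 h1
    refine Integrable.of_bound (C := 1) (by fun_prop) (Eventually.of_forall fun l => ?_)
    rw [Real.norm_of_nonneg (by positivity)]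
    exact pow_le_one₀ h0 h1
  -- The number `q` is a convex combination of `p` and `1`, and all three are fixed points. Strict
  -- convexity of `x ^ k` for `k ≥ 2` then forces `n ≤ 1` almost surely, against the mean.
  set c : ℝ := (1 - q) / (1 - p) with hc
  have hc0 : 0 < c := div_pos (by linarith) (by linarith)
  have hc1 : c < 1 := by rw [hc, div_lt_one (by linarith)]; linarith
  have hcq : c * p + (1 - c) * 1 = q := by
    have : 1 - p ≠ 0 := by linarith
    rw [hc]; field_simp; ring
  have hstrict : ∀ k : ℕ, 2 ≤ k → q ^ k < c * p ^ k + (1 - c) := by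
    intro k hk
    have := (strictConvexOn_pow hk).2 (mem_Ici.2 hp) (mem_Ici.2 zero_le_one)
      (by linarith : p ≠ 1) hc0 (by linarith : 0 < 1 - c) (by ring)
    simp only [smul_eq_mul, hcq] at this
    simpa using this
  have hnn : ∀ k : ℕ, 0 ≤ c * p ^ k + (1 - c) - q ^ k := by
    intro k
    rcases k with _ | _ | k
    · simp
    · simp; linarith
    · linarith [hstrict (k + 2) (by omega)]
  have hip := hint p hp (by linarith)
  have hiq := hint q (by linarith) hq.le
  have hzero : ∫ l, (c * p ^ n l + (1 - c) - q ^ n l) ∂μ = 0 := by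
    rw [integral_sub (by fun_prop) hiq, integral_add (by fun_prop) (by fun_prop),
      integral_const_mul, hpf, hqf]
    simp; linarith
  rw [integral_eq_zero_iff_of_nonneg (fun l => hnn (n l)) (by fun_prop)] at hzero
  have hle : ∫ l, (n l : ℝ) ∂μ ≤ ∫ _, (1 : ℝ) ∂μ := by
    refine integral_mono_ae ?_ (by fun_prop) ?_
    · refine Integrable.of_bound (C := B) (by fun_prop) (Eventually.of_forall fun l => ?_)
      simpa using hB l
    · filter_upwards [hzero] with l hl
      by_contra hcon
      have : 2 ≤ n l := by
        have : (1 : ℝ) < n l := not_le.1 hcon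
        exact_mod_cast this
      have := hstrict _ this
      simp only [Pi.zero_apply] at hl
      linarith
  simp at hle
  linarith

variable [MeasurableSpace L]

@[fun_prop]
theorem measurable_extinctionProb (hm : ∀ j, Measurable fun l => a l j) (n : ℕ) :
    Measurable (extinctionProb a n) := by
  induction n with
  | zero => exact measurable_const
  | succ n ih =>
    change Measurable fun τ : List (Fin B) → L =>
      ∏ j, (1 - a (τ []) j * (1 - extinctionProb a n (childTree j τ)))
    refine Finset.measurable_fun_prod _ fun j _ => ?_
    have h1 : Measurable fun τ : List (Fin B) → L => a (τ []) j :=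
      (hm j).comp (measurable_pi_apply [])
    have h2 := ih.comp (measurable_childTree (L := L) j)
    exact measurable_const.sub (h1.mul (measurable_const.sub h2))

theorem measurable_extinctionLimit (hm : ∀ j, Measurable fun l => a l j) :
    Measurable (extinctionLimit a) :=
  Measurable.iSup fun n => measurable_extinctionProb hm n

variable (μ : Measure L) [IsProbabilityMeasure μ]

/-- The bound `1 - q` on the mean extinction probability is preserved from level to level for small
`q`: by independence of the subtrees the next mean is at most `1 - q * m + q ^ 2 * B ^ 2`. -/
theorem exists_lintegral_extinctionProb_le (ha : ∀ l j, a l j ∈ Icc (0 : ℝ) 1)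
    (hm : ∀ j, Measurable fun l => a l j) (hmean : 1 < ∫ l, ∑ j, a l j ∂μ) :
    ∃ p : ℝ, p < 1 ∧
      ∀ n, ∫⁻ τ, ENNReal.ofReal (extinctionProb a n τ) ∂labelLaw μ B ≤ ENNReal.ofReal p := by
  set m := ∫ l, ∑ j, a l j ∂μ
  have hS : ∀ l, ∑ j, a l j ∈ Icc (0 : ℝ) B := fun l =>
    ⟨Finset.sum_nonneg fun j _ => (ha l j).1, by
      simpa using Finset.sum_le_sum fun j (_ : j ∈ Finset.univ) => (ha l j).2⟩
  have hSi : Integrable (fun l => ∑ j, a l j) μ := by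
    refine Integrable.of_bound (C := B) (by fun_prop) (Eventually.of_forall fun l => ?_)
    rw [Real.norm_of_nonneg (hS l).1]; exact (hS l).2
  -- The last condition is exactly what makes `1 - q * m + q ^ 2 * B ^ 2 ≤ 1 - q`.
  obtain ⟨q, hq0, hq1, hq⟩ : ∃ q : ℝ, 0 < q ∧ q ≤ 1 ∧ q * (B : ℝ) ^ 2 ≤ m - 1 := by
    refine ⟨min 1 ((m - 1) / ((B : ℝ) ^ 2 + 1)), ?_, min_le_left _ _, ?_⟩
    · exact lt_min one_pos (div_pos (by linarith) (by positivity))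
    · calc _ ≤ (m - 1) / ((B : ℝ) ^ 2 + 1) * (B : ℝ) ^ 2 := by gcongr; exact min_le_right _ _
        _ ≤ (m - 1) / ((B : ℝ) ^ 2 + 1) * ((B : ℝ) ^ 2 + 1) := by
          have : 0 ≤ (m - 1) / ((B : ℝ) ^ 2 + 1) := div_nonneg (by linarith) (by positivity)
          exact mul_le_mul_of_nonneg_left (by linarith) this
        _ = m - 1 := by field_simp
  have hterm : ∀ l j, a l j * q ∈ Icc (0 : ℝ) 1 := fun l j =>
    ⟨mul_nonneg (ha l j).1 hq0.le, mul_le_one₀ (ha l j).2 hq0.le hq1⟩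
  have hprod : ∀ l, ∏ j, (1 - a l j * q) ≤ 1 - q * ∑ j, a l j + q ^ 2 * (B : ℝ) ^ 2 := by
    intro l
    refine (prod_one_sub_le _ _ fun j _ => hterm l j).trans ?_
    rw [← Finset.sum_mul]
    have := pow_le_pow_left₀ (hS l).1 (hS l).2 2
    nlinarith [sq_nonneg q]
  refine ⟨1 - q, by linarith, fun n => ?_⟩
  induction n with
  | zero => simp [extinctionProb]
  | succ n ih =>
    have hD := measurable_extinctionProb hm n
    calc ∫⁻ τ, ENNReal.ofReal (extinctionProb a (n + 1) τ) ∂labelLaw μ B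
        = ∫⁻ τ, ∏ j, ENNReal.ofReal
            (1 - a (τ []) j * (1 - extinctionProb a n (childTree j τ))) ∂labelLaw μ B := by
          refine lintegral_congr fun τ => ?_
          rw [extinctionProb, ENNReal.ofReal_prod_of_nonneg]
          intro j _
          obtain ⟨h1, h2⟩ := ha (τ []) j
          obtain ⟨h3, h4⟩ := extinctionProb_mem ha n (childTree j τ)
          nlinarith
      _ = ∫⁻ l, ∏ j, ∫⁻ τ, ENNReal.ofReal (1 - a l j * (1 - extinctionProb a n τ))
            ∂labelLaw μ B ∂μ := by
          refine lintegral_prod_childTree μ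
            (fun j p => ENNReal.ofReal (1 - a p.1 j * (1 - extinctionProb a n p.2))) fun j => ?_
          have h1 : Measurable fun p : L × (List (Fin B) → L) => a p.1 j :=
            (hm j).comp measurable_fst
          have h2 : Measurable fun p : L × (List (Fin B) → L) => extinctionProb a n p.2 :=
            hD.comp measurable_snd
          fun_prop
      _ ≤ ∫⁻ l, ENNReal.ofReal (∏ j, (1 - a l j * q)) ∂μ := by
          refine lintegral_mono fun l => ?_
          rw [ENNReal.ofReal_prod_of_nonneg fun j _ => by linarith [(hterm l j).2]]
          refine Finset.prod_le_prod' fun j _ => ?_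
          obtain ⟨h1, h2⟩ := ha l j
          calc ∫⁻ τ, ENNReal.ofReal (1 - a l j * (1 - extinctionProb a n τ)) ∂labelLaw μ B
              = ∫⁻ τ, (ENNReal.ofReal (1 - a l j) +
                  ENNReal.ofReal (a l j) * ENNReal.ofReal (extinctionProb a n τ))
                  ∂labelLaw μ B := by
                refine lintegral_congr fun τ => ?_
                rw [← ENNReal.ofReal_mul h1, ← ENNReal.ofReal_add (by linarith)
                  (mul_nonneg h1 (extinctionProb_mem ha n τ).1)]
                congr 1; ring
            _ = ENNReal.ofReal (1 - a l j) + ENNReal.ofReal (a l j) *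
                  ∫⁻ τ, ENNReal.ofReal (extinctionProb a n τ) ∂labelLaw μ B := by
                rw [lintegral_add_left measurable_const, lintegral_const_mul _ (by fun_prop)]
                simp
            _ ≤ ENNReal.ofReal (1 - a l j) + ENNReal.ofReal (a l j) * ENNReal.ofReal (1 - q) := by
                gcongr
            _ = ENNReal.ofReal (1 - a l j * q) := by
                rw [← ENNReal.ofReal_mul h1, ← ENNReal.ofReal_add (by linarith)
                  (mul_nonneg h1 (by linarith))]
                congr 1; ring
      _ ≤ ∫⁻ l, ENNReal.ofReal (1 - q * ∑ j, a l j + q ^ 2 * (B : ℝ) ^ 2) ∂μ := by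
          exact lintegral_mono fun l => ENNReal.ofReal_le_ofReal (hprod l)
      _ = ENNReal.ofReal (∫ l, (1 - q * ∑ j, a l j + q ^ 2 * (B : ℝ) ^ 2) ∂μ) := by
          rw [ofReal_integral_eq_lintegral_ofReal (by fun_prop)]
          exact Eventually.of_forall fun l =>
            (Finset.prod_nonneg fun j _ => by linarith [(hterm l j).2]).trans (hprod l)
      _ ≤ ENNReal.ofReal (1 - q) := by
          refine ENNReal.ofReal_le_ofReal ?_
          rw [integral_add (by fun_prop) (by fun_prop), integral_sub (by fun_prop) (by fun_prop),
            integral_const_mul]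
          simp only [integral_const, probReal_univ, smul_eq_mul, one_mul]
          change 1 - q * m + _ ≤ _
          nlinarith

/-- The uniform bound on the means passes to the limit by monotone convergence, and the indicator of
the event lies below `extinctionLimit a`. -/
theorem measure_extinctionLimit_eq_one_lt (ha : ∀ l j, a l j ∈ Icc (0 : ℝ) 1)
    (hm : ∀ j, Measurable fun l => a l j) (hmean : 1 < ∫ l, ∑ j, a l j ∂μ) :
    labelLaw μ B {τ | extinctionLimit a τ = 1} < 1 := by
  obtain ⟨p, hp, h⟩ := exists_lintegral_extinctionProb_le μ ha hm hmean
  have hlim : ∫⁻ τ, ENNReal.ofReal (extinctionLimit a τ) ∂labelLaw μ B ≤ ENNReal.ofReal p := by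
    refine le_of_tendsto' (lintegral_tendsto_of_tendsto_of_monotone
      (f := fun n τ => ENNReal.ofReal (extinctionProb a n τ))
      (fun n => (measurable_extinctionProb hm n).ennreal_ofReal.aemeasurable)
      (Eventually.of_forall fun τ => monotone_nat_of_le_succ fun n =>
        ENNReal.ofReal_le_ofReal (extinctionProb_le_succ ha n τ))
      (Eventually.of_forall fun τ =>
        (ENNReal.continuous_ofReal.tendsto _).comp (tendsto_extinctionProb ha τ))) h
  have hZ : MeasurableSet {τ | extinctionLimit a τ = 1} :=
    measurableSet_eq_fun (measurable_extinctionLimit hm) measurable_const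
  calc labelLaw μ B {τ | extinctionLimit a τ = 1}
      = ∫⁻ τ, {τ | extinctionLimit a τ = 1}.indicator 1 τ ∂labelLaw μ B := by
        rw [lintegral_indicator_one hZ]
    _ ≤ ∫⁻ τ, ENNReal.ofReal (extinctionLimit a τ) ∂labelLaw μ B := by
        refine lintegral_mono fun τ => ?_
        by_cases hτ : extinctionLimit a τ = 1
        · simp [hτ]
        · simp [hτ]
    _ ≤ ENNReal.ofReal p := hlim
    _ < 1 := by rw [← ENNReal.ofReal_one]; exact (ENNReal.ofReal_lt_ofReal_iff one_pos).2 hp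

/-- The probability that the percolation cluster of the root is almost surely finite is a fixed
point of the generating function of the number of children. -/
theorem integral_pow_measure_extinctionLimit (ha : ∀ l j, a l j ∈ Icc (0 : ℝ) 1)
    (hm : ∀ j, Measurable fun l => a l j) {n : L → ℕ} (hn : Measurable n)
    (hna : ∀ l, n l = (Finset.univ.filter fun j => 0 < a l j).card) :
    ∫ l, (labelLaw μ B).real {τ | extinctionLimit a τ = 1} ^ n l ∂μ =
      (labelLaw μ B).real {τ | extinctionLimit a τ = 1} := by
  set Z := {τ | extinctionLimit a τ = 1} with hZdef
  have hZ : MeasurableSet Z := measurableSet_eq_fun (measurable_extinctionLimit hm) measurable_const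
  classical
  have key : labelLaw μ B Z = ∫⁻ l, labelLaw μ B Z ^ n l ∂μ := by
    have h := lintegral_prod_childTree μ
      (fun j (p : L × (List (Fin B) → L)) => if 0 < a p.1 j then Z.indicator 1 p.2 else 1)
      (fun j => by
        refine Measurable.ite (measurableSet_lt measurable_const ((hm j).comp measurable_fst))
          ?_ measurable_const
        exact (measurable_one.indicator hZ).comp measurable_snd)
    -- By `extinctionLimit_eq_one_iff` the indicator of `Z` factors over the children with positive
    -- weight, so the branching formula applies.
    have h1 : ∀ τ : List (Fin B) → L, (∏ j, if 0 < a (τ []) j then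
        Z.indicator (1 : (List (Fin B) → L) → ℝ≥0∞) (childTree j τ) else 1) =
        Z.indicator 1 τ := by
      intro τ
      by_cases hτ : τ ∈ Z
      · have := (extinctionLimit_eq_one_iff ha τ).1 hτ
        rw [indicator_of_mem hτ]
        refine Finset.prod_eq_one fun j _ => ?_
        split_ifs with hj
        · exact indicator_of_mem (s := Z) (this j hj) (1 : (List (Fin B) → L) → ℝ≥0∞)
        · rfl
      · rw [indicator_of_notMem hτ]
        have : ¬ ∀ j, 0 < a (τ []) j → extinctionLimit a (childTree j τ) = 1 := fun h =>
          hτ ((extinctionLimit_eq_one_iff ha τ).2 h)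
        push Not at this
        obtain ⟨j, hj, hj1⟩ := this
        refine Finset.prod_eq_zero (Finset.mem_univ j) ?_
        rw [if_pos hj]
        exact indicator_of_notMem (s := Z) hj1 _
    have h2 : ∀ l, (∏ j : Fin B, ∫⁻ τ, (if 0 < a l j then
        Z.indicator (1 : (List (Fin B) → L) → ℝ≥0∞) τ else 1) ∂labelLaw μ B) =
        labelLaw μ B Z ^ n l := by
      intro l
      have : ∀ j, (∫⁻ τ, (if 0 < a l j then
        Z.indicator (1 : (List (Fin B) → L) → ℝ≥0∞) τ else 1) ∂labelLaw μ B) =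
          if 0 < a l j then labelLaw μ B Z else 1 := by
        intro j
        split_ifs
        · exact lintegral_indicator_one hZ
        · simp
      rw [Finset.prod_congr rfl fun j _ => this j, Finset.prod_ite, hna]
      simp
    simp only [h1, h2] at h
    rw [← h, lintegral_indicator_one hZ]
  rw [integral_eq_lintegral_of_nonneg_ae (Eventually.of_forall fun l => by positivity)
    (by fun_prop)]
  conv_rhs => rw [measureReal_def, key]
  congr 1
  refine lintegral_congr fun l => ?_
  rw [ENNReal.ofReal_pow measureReal_nonneg, ofReal_measureReal]

/-- If the mean number of kept edges is larger than `1`, then the percolation cluster of the root is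
infinite with positive probability, for almost every tree without extinction. -/
theorem ae_extinctionLimit_lt_one (ha : ∀ l j, a l j ∈ Icc (0 : ℝ) 1)
    (hm : ∀ j, Measurable fun l => a l j) (hmean : 1 < ∫ l, ∑ j, a l j ∂μ) {n : L → ℕ}
    (hn : Measurable n) (hna : ∀ l, n l = (Finset.univ.filter fun j => 0 < a l j).card) :
    ∀ᵐ τ ∂labelLaw μ B, extinctionLimit (fun l j => if 0 < a l j then 1 else 0) τ ≠ 1 →
      extinctionLimit a τ < 1 := by
  classical
  set b : L → Fin B → ℝ := fun l j => if 0 < a l j then 1 else 0 with hbdef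
  have hb : ∀ l j, b l j ∈ Icc (0 : ℝ) 1 := fun l j => by simp only [hbdef]; split_ifs <;> simp
  have hbm : ∀ j, Measurable fun l => b l j := fun j =>
    Measurable.ite (measurableSet_lt measurable_const (hm j)) measurable_const measurable_const
  have hab : ∀ l j, a l j ≤ b l j := fun l j => by
    simp only [hbdef]; split_ifs with h
    · exact (ha l j).2
    · exact not_lt.1 h
  have hpos : ∀ l j, 0 < b l j ↔ 0 < a l j := fun l j => by
    simp only [hbdef]; split_ifs with h <;> simp [h]
  have hsum : ∀ l, ∑ j, b l j = n l := fun l => by simp [hbdef, hna]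
  have hint : ∀ c : L → Fin B → ℝ, (∀ l j, c l j ∈ Icc (0 : ℝ) 1) →
      (∀ j, Measurable fun l => c l j) → Integrable (fun l => ∑ j, c l j) μ := by
    intro c hc hcm
    refine integrable_finsetSum _ fun j _ => ?_
    refine Integrable.of_bound (C := 1) (hcm j).aestronglyMeasurable
      (Eventually.of_forall fun l => ?_)
    rw [Real.norm_of_nonneg (hc l j).1]; exact (hc l j).2
  have hbmean : 1 < ∫ l, ∑ j, b l j ∂μ :=
    hmean.trans_le (integral_mono (hint a ha hm) (hint b hb hbm)
      fun l => Finset.sum_le_sum fun j _ => hab l j)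
  have hsub : {τ : List (Fin B) → L | extinctionLimit b τ = 1} ⊆ {τ | extinctionLimit a τ = 1} := by
    intro τ hτ
    refine le_antisymm (extinctionLimit_mem ha τ).2 ?_
    rw [← show extinctionLimit b τ = 1 from hτ]
    exact ciSup_mono (bddAbove_extinctionProb ha τ)
      fun k => extinctionProb_antitone ha hb hab k τ
  -- Both probabilities are fixed points below `1` of the same generating function. Equal measure
  -- together with the inclusion `hsub` makes the two events agree almost surely.
  have hreal := generatingFunction_fixedPoint_unique (B := B) μ hn
    (fun l => by rw [hna]; simpa using Finset.card_filter_le Finset.univ fun j => 0 < a l j)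
    (by simpa only [hsum] using hbmean) measureReal_nonneg
    (by
      have := measure_extinctionLimit_eq_one_lt μ ha hm hmean
      rw [measureReal_def]
      simpa using (ENNReal.toReal_lt_toReal (measure_ne_top _ _) ENNReal.one_ne_top).2 this)
    (integral_pow_measure_extinctionLimit μ hb hbm hn (by simpa only [hpos] using hna))
    (integral_pow_measure_extinctionLimit μ ha hm hn hna)
    (measureReal_mono hsub)
  have hmeas : labelLaw μ B {τ | extinctionLimit a τ = 1} ≤
      labelLaw μ B {τ | extinctionLimit b τ = 1} := by
    rw [← ofReal_measureReal, ← ofReal_measureReal, hreal]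
  have hae := ae_eq_of_subset_of_measure_ge hsub hmeas
    (measurableSet_eq_fun (measurable_extinctionLimit hbm) measurable_const).nullMeasurableSet
    (measure_ne_top _ _)
  filter_upwards [hae] with τ hτ hne
  refine lt_of_le_of_ne (extinctionLimit_mem ha τ).2 fun h1 => hne ?_
  have : (τ ∈ {τ | extinctionLimit b τ = 1}) = (τ ∈ {τ | extinctionLimit a τ = 1}) := hτ
  have h2 : τ ∈ {τ | extinctionLimit b τ = 1} := this ▸ h1
  exact h2

end Extinction

/-! ### Exponential moments of total weights in the subcritical case -/

/-- The subtree at the vertex `v`. -/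
def descendantTree {L : Type*} {B : ℕ} (v : List (Fin B)) (τ : List (Fin B) → L) :
    List (Fin B) → L :=
  fun w => τ (v ++ w)

section BranchSum

variable {L : Type*} {B : ℕ}

/-- The sum, over the vertices of level at most `n`, of the products of the weights `a l j` along
the path to the vertex. -/
def branchSum (a : L → Fin B → ℝ) : ℕ → (List (Fin B) → L) → ℝ
  | 0, _ => 1
  | n + 1, τ => 1 + ∑ j, a (τ []) j * branchSum a n (childTree j τ)

/-- The sum of the values of `g` at the subtrees of level `n`. -/
def generationSum (g : (List (Fin B) → L) → ℝ≥0∞) : ℕ → (List (Fin B) → L) → ℝ≥0∞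
  | 0, τ => g τ
  | n + 1, τ => ∑ j, generationSum g n (childTree j τ)

theorem le_generationSum (g : (List (Fin B) → L) → ℝ≥0∞) (v : List (Fin B))
    (τ : List (Fin B) → L) : g (descendantTree v τ) ≤ generationSum g v.length τ := by
  induction v generalizing τ with
  | nil => exact le_rfl
  | cons j v ih =>
    exact (ih (childTree j τ)).trans
      (Finset.single_le_sum (f := fun j => generationSum g v.length (childTree j τ))
        (fun _ _ => zero_le) (Finset.mem_univ j))

variable {a : L → Fin B → ℝ}

theorem one_le_branchSum (ha : ∀ l j, 0 ≤ a l j) (n : ℕ) (τ : List (Fin B) → L) :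
    1 ≤ branchSum a n τ := by
  induction n generalizing τ with
  | zero => exact le_rfl
  | succ n ih =>
    have : 0 ≤ ∑ j, a (τ []) j * branchSum a n (childTree j τ) :=
      Finset.sum_nonneg fun j _ => mul_nonneg (ha _ j) (zero_le_one.trans (ih _))
    simpa [branchSum] using this

theorem branchSum_le_succ (ha : ∀ l j, 0 ≤ a l j) (n : ℕ) (τ : List (Fin B) → L) :
    branchSum a n τ ≤ branchSum a (n + 1) τ := by
  induction n generalizing τ with
  | zero => exact one_le_branchSum ha 1 τ
  | succ n ih =>
    simp only [branchSum]
    exact add_le_add_right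
      (Finset.sum_le_sum fun j _ => mul_le_mul_of_nonneg_left (ih (childTree j τ)) (ha _ j)) 1

variable [MeasurableSpace L]

theorem measurable_branchSum (hm : ∀ j, Measurable fun l => a l j) (n : ℕ) :
    Measurable (branchSum a n) := by
  induction n with
  | zero => exact measurable_const
  | succ n ih =>
    change Measurable fun τ : List (Fin B) → L =>
      1 + ∑ j, a (τ []) j * branchSum a n (childTree j τ)
    refine measurable_const.add (Finset.measurable_fun_sum _ fun j _ => ?_)
    exact ((hm j).comp (measurable_pi_apply [])).mul (ih.comp (measurable_childTree j))

theorem measurable_generationSum {g : (List (Fin B) → L) → ℝ≥0∞} (hg : Measurable g) (n : ℕ) :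
    Measurable (generationSum g n) := by
  induction n with
  | zero => exact hg
  | succ n ih => exact Finset.measurable_fun_sum _ fun j _ => ih.comp (measurable_childTree j)

variable (μ : Measure L) [IsProbabilityMeasure μ]

theorem lintegral_generationSum {g : (List (Fin B) → L) → ℝ≥0∞} (hg : Measurable g) (n : ℕ) :
    ∫⁻ τ, generationSum g n τ ∂labelLaw μ B = (B : ℝ≥0∞) ^ n * ∫⁻ τ, g τ ∂labelLaw μ B := by
  induction n with
  | zero => simp [generationSum]
  | succ n ih =>
    have hG := measurable_generationSum hg n
    simp only [generationSum]
    rw [lintegral_finsetSum (f := fun j τ => generationSum g n (childTree j τ)) _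
        fun j _ => hG.comp (measurable_childTree j),
      Finset.sum_congr rfl fun j _ =>
        (measurePreserving_childTree μ j).lintegral_comp hG, ih]
    simp [pow_succ']
    ring

/-- If the mean of the sum of the weights is smaller than `1`, then the branching sums have
uniformly bounded exponential moments. -/
theorem exists_lintegral_exp_branchSum_le (ha : ∀ l j, a l j ∈ Icc (0 : ℝ) 1)
    (hm : ∀ j, Measurable fun l => a l j) (hmean : ∫ l, ∑ j, a l j ∂μ < 1) :
    ∃ A θ₀ : ℝ, 0 < θ₀ ∧ ∀ n, ∀ θ, 0 ≤ θ → θ ≤ θ₀ →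
      ∫⁻ τ, ENNReal.ofReal (Real.exp (θ * branchSum a n τ)) ∂labelLaw μ B ≤
        ENNReal.ofReal (Real.exp (A * θ)) := by
  set m := ∫ l, ∑ j, a l j ∂μ
  have hS : ∀ l, ∑ j, a l j ∈ Icc (0 : ℝ) B := fun l =>
    ⟨Finset.sum_nonneg fun j _ => (ha l j).1, by
      simpa using Finset.sum_le_sum fun j (_ : j ∈ Finset.univ) => (ha l j).2⟩
  have hSi : Integrable (fun l => ∑ j, a l j) μ := by
    refine Integrable.of_bound (C := B) (by fun_prop) (Eventually.of_forall fun l => ?_)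
    rw [Real.norm_of_nonneg (hS l).1]; exact (hS l).2
  have hm0 : 0 ≤ m := integral_nonneg fun l => (hS l).1
  -- With this `A`, `θ + A * θ * m = (A - 1) * θ`. The remaining `θ` pays for the quadratic error
  -- `(A * θ * B) ^ 2`, which is at most `θ` for `θ` below the threshold chosen next.
  set A : ℝ := 2 / (1 - m) with hA
  have h1m : 0 < 1 - m := by linarith
  have hA1 : 1 ≤ A := by rw [hA, le_div_iff₀ h1m]; linarith
  have hAm : A * m = A - 2 := by rw [hA]; field_simp; ring
  have hden : 0 < A ^ 2 * ((B : ℝ) + 1) ^ 2 := by positivity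
  refine ⟨A, (A ^ 2 * ((B : ℝ) + 1) ^ 2)⁻¹, inv_pos.2 hden, fun n => ?_⟩
  induction n with
  | zero =>
    intro θ h0 _
    simp only [branchSum, lintegral_const, measure_univ, mul_one]
    exact ENNReal.ofReal_le_ofReal (Real.exp_le_exp.2 (by nlinarith))
  | succ n ih =>
    intro θ h0 hθ
    have hθ' : A ^ 2 * ((B : ℝ) + 1) ^ 2 * θ ≤ 1 := by
      calc _ ≤ A ^ 2 * ((B : ℝ) + 1) ^ 2 * (A ^ 2 * ((B : ℝ) + 1) ^ 2)⁻¹ := by gcongr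
        _ = 1 := mul_inv_cancel₀ hden.ne'
    have hY := measurable_branchSum hm n
    have hB0 : (0 : ℝ) ≤ B := B.cast_nonneg
    have hAB : A * θ * B ≤ 1 := by
      refine le_trans ?_ hθ'
      have h2 : A * B ≤ A ^ 2 * ((B : ℝ) + 1) ^ 2 := by nlinarith
      nlinarith
    calc ∫⁻ τ, ENNReal.ofReal (Real.exp (θ * branchSum a (n + 1) τ)) ∂labelLaw μ B
        = ∫⁻ τ, ENNReal.ofReal (Real.exp θ) * ∏ j, ENNReal.ofReal
            (Real.exp (θ * a (τ []) j * branchSum a n (childTree j τ))) ∂labelLaw μ B := by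
          refine lintegral_congr fun τ => ?_
          rw [← ENNReal.ofReal_prod_of_nonneg fun j _ => (Real.exp_pos _).le,
            ← ENNReal.ofReal_mul (Real.exp_pos _).le, ← Real.exp_sum, ← Real.exp_add]
          simp only [branchSum, mul_add, mul_one, Finset.mul_sum, mul_assoc]
      _ = ENNReal.ofReal (Real.exp θ) * ∫⁻ l, ∏ j, ∫⁻ τ, ENNReal.ofReal
            (Real.exp (θ * a l j * branchSum a n τ)) ∂labelLaw μ B ∂μ := by
          have hmeas : ∀ j : Fin B, Measurable fun p : L × (List (Fin B) → L) =>
              ENNReal.ofReal (Real.exp (θ * a p.1 j * branchSum a n p.2)) := by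
            intro j
            have h1 : Measurable fun p : L × (List (Fin B) → L) => a p.1 j :=
              (hm j).comp measurable_fst
            have h2 : Measurable fun p : L × (List (Fin B) → L) => branchSum a n p.2 :=
              hY.comp measurable_snd
            fun_prop
          rw [lintegral_const_mul]
          · rw [lintegral_prod_childTree μ _ hmeas]
          · refine Finset.measurable_fun_prod _ fun j _ => ?_
            exact (hmeas j).comp
              (((measurable_pi_apply []).prodMk (measurable_childTree j)))
      _ ≤ ENNReal.ofReal (Real.exp θ) *
            ∫⁻ l, ENNReal.ofReal (1 + A * θ * ∑ j, a l j + (A * θ * B) ^ 2) ∂μ := by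
          gcongr with l
          calc ∏ j, ∫⁻ τ, ENNReal.ofReal (Real.exp (θ * a l j * branchSum a n τ)) ∂labelLaw μ B
              ≤ ∏ j, ENNReal.ofReal (Real.exp (A * (θ * a l j))) := by
                -- The induction hypothesis is used with `θ * a l j`, which is still below the
                -- threshold because `a l j ≤ 1`.
                refine Finset.prod_le_prod' fun j _ => ih _ (mul_nonneg h0 (ha l j).1) ?_
                exact (mul_le_of_le_one_right h0 (ha l j).2).trans hθ
            _ = ENNReal.ofReal (Real.exp (A * θ * ∑ j, a l j)) := by
                rw [← ENNReal.ofReal_prod_of_nonneg fun j _ => (Real.exp_pos _).le,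
                  ← Real.exp_sum, Finset.mul_sum]
                simp only [mul_assoc]
            _ ≤ _ := by
                refine ENNReal.ofReal_le_ofReal ?_
                have hx0 : 0 ≤ A * θ * ∑ j, a l j := mul_nonneg (by positivity) (hS l).1
                have hx1 : A * θ * ∑ j, a l j ≤ A * θ * B :=
                  mul_le_mul_of_nonneg_left (hS l).2 (by positivity)
                have := (abs_le.1 (Real.abs_exp_sub_one_sub_id_le
                  (x := A * θ * ∑ j, a l j) (by rw [abs_of_nonneg hx0]; linarith))).2
                have := pow_le_pow_left₀ hx0 hx1 2
                linarith
      _ = ENNReal.ofReal (Real.exp θ * (1 + A * θ * m + (A * θ * B) ^ 2)) := by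
          rw [ENNReal.ofReal_mul (Real.exp_pos _).le, ← ofReal_integral_eq_lintegral_ofReal]
          · rw [integral_add (by fun_prop) (by fun_prop), integral_add (by fun_prop) (by fun_prop),
              integral_const_mul]
            simp [m]
          · fun_prop
          · refine Eventually.of_forall fun l => ?_
            have := (hS l).1
            simp only [Pi.zero_apply]
            positivity
      _ ≤ ENNReal.ofReal (Real.exp (A * θ)) := by
          refine ENNReal.ofReal_le_ofReal ?_
          calc _ ≤ Real.exp θ * Real.exp (A * θ * m + (A * θ * B) ^ 2) := by
                gcongr
                have := Real.add_one_le_exp (A * θ * m + (A * θ * B) ^ 2)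
                linarith
            _ = Real.exp (θ + (A * θ * m + (A * θ * B) ^ 2)) := (Real.exp_add _ _).symm
            _ ≤ _ := by
                refine Real.exp_le_exp.2 ?_
                have h3 : A ^ 2 * (B : ℝ) ^ 2 * θ ≤ 1 := by
                  refine le_trans ?_ hθ'
                  gcongr
                  linarith
                have h4 : A * θ * m = θ * (A - 2) := by rw [← hAm]; ring
                have h5 : (A * θ * B) ^ 2 = θ * (A ^ 2 * (B : ℝ) ^ 2 * θ) := by ring
                rw [h4, h5]
                nlinarith

/-- If the mean of the sum of the weights is smaller than `1`, then almost surely the branching sums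
of all subtrees grow at most linearly in the level. -/
theorem ae_branchSum_descendantTree_le (ha : ∀ l j, a l j ∈ Icc (0 : ℝ) 1)
    (hm : ∀ j, Measurable fun l => a l j) (hmean : ∫ l, ∑ j, a l j ∂μ < 1) :
    ∀ᵐ τ ∂labelLaw μ B, ∃ C K : ℝ, 0 ≤ C ∧ 0 ≤ K ∧
      ∀ v n, branchSum a n (descendantTree v τ) ≤ C + K * (v.length : ℝ) := by
  obtain ⟨A, θ, hθ, hexp⟩ := exists_lintegral_exp_branchSum_le μ ha hm hmean
  -- The supremum over `n` gives one event for all depths; monotonicity in `n` keeps the moment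
  -- bound.
  set g : (List (Fin B) → L) → ℝ≥0∞ :=
    fun τ => ⨆ n, ENNReal.ofReal (Real.exp (θ * branchSum a n τ)) with hg
  have hgn : ∀ n, Measurable fun τ => ENNReal.ofReal (Real.exp (θ * branchSum a n τ)) := fun n =>
    ((measurable_branchSum hm n).const_mul θ).exp.ennreal_ofReal
  have hgm : Measurable g := Measurable.iSup hgn
  have hgi : ∫⁻ τ, g τ ∂labelLaw μ B ≤ ENNReal.ofReal (Real.exp (A * θ)) := by
    rw [lintegral_iSup hgn]
    · exact iSup_le fun n => hexp n θ hθ.le le_rfl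
    · refine monotone_nat_of_le_succ fun n τ => ENNReal.ofReal_le_ofReal (Real.exp_le_exp.2 ?_)
      exact mul_le_mul_of_nonneg_left (branchSum_le_succ (fun l j => (ha l j).1) n τ) hθ.le
  -- There are `B ^ n` vertices at level `n`, and `γ * B ≤ 1 / 2` makes the damped sum over all
  -- vertices integrable. If that sum is finite, each term is at most the sum, and its logarithm is
  -- linear in the level.
  set γ : ℝ≥0 := (2 * ((B : ℝ≥0) + 1))⁻¹ with hγ
  have hγ0 : 0 < γ := by positivity
  have hγB : γ * (B : ℝ≥0) ≤ 2⁻¹ := by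
    calc γ * (B : ℝ≥0) ≤ γ * ((B : ℝ≥0) + 1) := by gcongr; simp
      _ = 2⁻¹ := by rw [hγ, mul_inv, mul_assoc, inv_mul_cancel₀ (by positivity), mul_one]
  have hsum : ∫⁻ τ, ∑' n, (γ : ℝ≥0∞) ^ n * generationSum g n τ ∂labelLaw μ B ≠ ∞ := by
    have hG : ∀ n, Measurable fun τ => (γ : ℝ≥0∞) ^ n * generationSum g n τ := fun n =>
      (measurable_generationSum hgm n).const_mul _
    rw [lintegral_tsum fun n => (hG n).aemeasurable]
    have : ∀ n, ∫⁻ τ, (γ : ℝ≥0∞) ^ n * generationSum g n τ ∂labelLaw μ B ≤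
        (2⁻¹ : ℝ≥0∞) ^ n * ENNReal.ofReal (Real.exp (A * θ)) := by
      intro n
      rw [lintegral_const_mul _ (measurable_generationSum hgm n), lintegral_generationSum μ hgm,
        ← mul_assoc, ← mul_pow]
      gcongr
      have : ((γ * (B : ℝ≥0) : ℝ≥0) : ℝ≥0∞) ≤ ((2⁻¹ : ℝ≥0) : ℝ≥0∞) := by exact_mod_cast hγB
      simpa using this
    refine ne_top_of_le_ne_top ?_ (ENNReal.tsum_le_tsum this)
    rw [ENNReal.tsum_mul_right, ENNReal.tsum_geometric]
    exact ENNReal.mul_ne_top (by simp) ENNReal.ofReal_ne_top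
  have hmeas : Measurable fun τ => ∑' n, (γ : ℝ≥0∞) ^ n * generationSum g n τ :=
    Measurable.tsum fun n => (measurable_generationSum hgm n).const_mul _
  filter_upwards [ae_lt_top hmeas hsum] with τ hτ
  set C := ∑' n, (γ : ℝ≥0∞) ^ n * generationSum g n τ
  have hγ1 : γ ≤ 1 := by
    rw [hγ]
    refine inv_le_one_of_one_le₀ ?_
    have : (1 : ℝ≥0) ≤ (B : ℝ≥0) + 1 := by simp
    calc (1 : ℝ≥0) ≤ 1 * ((B : ℝ≥0) + 1) := by simp
      _ ≤ _ := by gcongr; norm_num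
  have hlog : Real.log (γ : ℝ) ≤ 0 := Real.log_nonpos γ.2 (by exact_mod_cast hγ1)
  refine ⟨|Real.log C.toReal| / θ, -Real.log γ / θ, by positivity,
    div_nonneg (by linarith) hθ.le, fun v n => ?_⟩
  have h1 : ENNReal.ofReal ((γ : ℝ) ^ v.length *
      Real.exp (θ * branchSum a n (descendantTree v τ))) ≤ C := by
    rw [ENNReal.ofReal_mul (by positivity), ENNReal.ofReal_pow γ.coe_nonneg]
    simp only [ENNReal.ofReal_coe_nnreal]
    calc _ ≤ (γ : ℝ≥0∞) ^ v.length * generationSum g v.length τ := by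
          gcongr
          refine le_trans ?_ (le_generationSum g v τ)
          exact le_iSup (fun n =>
            ENNReal.ofReal (Real.exp (θ * branchSum a n (descendantTree v τ)))) n
      _ ≤ C := ENNReal.le_tsum (f := fun n => (γ : ℝ≥0∞) ^ n * generationSum g n τ) _
  have h2 := (ENNReal.ofReal_le_iff_le_toReal hτ.ne).1 h1
  have hγr : (0 : ℝ) < γ := by exact_mod_cast hγ0
  have h3 := Real.log_le_log (by positivity) h2
  rw [Real.log_mul (by positivity) (by positivity), Real.log_exp, Real.log_pow] at h3
  rw [div_mul_eq_mul_div, ← add_div, le_div_iff₀ hθ]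
  have := le_abs_self (Real.log C.toReal)
  linarith

end BranchSum

/-! ### Elementary properties of covering numbers -/

section CoverNumber

variable {X : Type*} [PseudoMetricSpace X]

/-- `ℕ∞` is well-ordered, so the infimum is attained; the cover by singletons shows that there is
something to minimise. -/
theorem exists_encard_eq_coverNumber (r : ℝ) (F : Set X) :
    ∃ 𝒰 : Set (Set X), (∀ U ∈ 𝒰, Metric.ediam U ≤ ENNReal.ofReal r) ∧ F ⊆ ⋃₀ 𝒰 ∧
      𝒰.encard = coverNumber r F := by
  have : Nonempty {𝒰 : Set (Set X) //
      (∀ U ∈ 𝒰, Metric.ediam U ≤ ENNReal.ofReal r) ∧ F ⊆ ⋃₀ 𝒰} :=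
    ⟨⟨range fun x => {x}, by rintro _ ⟨x, rfl⟩; simp, fun x _ => ⟨{x}, ⟨x, rfl⟩, rfl⟩⟩⟩
  have h := ciInf_mem fun 𝒰 : {𝒰 : Set (Set X) //
      (∀ U ∈ 𝒰, Metric.ediam U ≤ ENNReal.ofReal r) ∧ F ⊆ ⋃₀ 𝒰} => (𝒰 : Set (Set X)).encard
  obtain ⟨⟨𝒰, h1, h2⟩, h3⟩ := h
  refine ⟨𝒰, h1, h2, ?_⟩
  rw [coverNumber, iInf_subtype']
  exact h3

theorem coverNumber_le {r : ℝ} {F : Set X} {𝒰 : Set (Set X)}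
    (h1 : ∀ U ∈ 𝒰, Metric.ediam U ≤ ENNReal.ofReal r) (h2 : F ⊆ ⋃₀ 𝒰) :
    coverNumber r F ≤ 𝒰.encard :=
  iInf₂_le 𝒰 ⟨h1, h2⟩

theorem coverNumber_mono {F G : Set X} (h : F ⊆ G) (r : ℝ) : coverNumber r F ≤ coverNumber r G := by
  obtain ⟨𝒰, h1, h2, h3⟩ := exists_encard_eq_coverNumber r G
  exact h3 ▸ coverNumber_le h1 (h.trans h2)

theorem coverNumber_biUnion_le {ι : Type*} (s : Finset ι) (A : ι → Set X) (r : ℝ) :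
    coverNumber r (⋃ i ∈ s, A i) ≤ ∑ i ∈ s, coverNumber r (A i) := by
  choose 𝒰 h1 h2 h3 using fun i => exists_encard_eq_coverNumber r (A i)
  calc coverNumber r (⋃ i ∈ s, A i) ≤ (⋃ i ∈ s, 𝒰 i).encard := by
        refine coverNumber_le (fun U hU => ?_) (iUnion₂_subset fun i hi x hx => ?_)
        · obtain ⟨i, _, hU⟩ := mem_iUnion₂.1 hU
          exact h1 i U hU
        · obtain ⟨U, hU, hxU⟩ := h2 i hx
          exact ⟨U, mem_iUnion₂.2 ⟨i, hi, hU⟩, hxU⟩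
    _ ≤ ∑ i ∈ s, (𝒰 i).encard := by
        classical
        induction s using Finset.induction_on with
        | empty => simp
        | insert i s hi ih =>
          rw [Finset.set_biUnion_insert, Finset.sum_insert hi]
          exact (encard_union_le _ _).trans (by gcongr)
    _ = _ := Finset.sum_congr rfl fun i _ => h3 i

theorem coverNumber_image_le {Y : Type*} [PseudoMetricSpace Y] {f : X → Y} {c : ℝ} (hc : 0 < c)
    (hf : ∀ x y, dist (f x) (f y) ≤ c * dist x y) (r : ℝ) (A : Set X) :
    coverNumber r (f '' A) ≤ coverNumber (r / c) A := by
  obtain ⟨𝒰, h1, h2, h3⟩ := exists_encard_eq_coverNumber (r / c) A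
  have hL : LipschitzWith c.toNNReal f := LipschitzWith.of_dist_le_mul fun x y => by
    rw [Real.coe_toNNReal c hc.le]; exact hf x y
  refine (coverNumber_le (𝒰 := (fun U => f '' U) '' 𝒰) ?_ ?_).trans
    ((encard_image_le _ _).trans h3.le)
  · rintro _ ⟨U, hU, rfl⟩
    refine (hL.ediam_image_le U).trans ?_
    calc _ ≤ ENNReal.ofReal c * ENNReal.ofReal (r / c) := by
          gcongr
          · exact le_rfl
          · exact h1 U hU
      _ = ENNReal.ofReal r := by
          rw [← ENNReal.ofReal_mul hc.le, mul_div_cancel₀ _ hc.ne']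
  · rintro _ ⟨x, hx, rfl⟩
    obtain ⟨U, hU, hxU⟩ := h2 hx
    exact ⟨_, ⟨U, hU, rfl⟩, mem_image_of_mem _ hxU⟩

theorem coverNumber_le_one {r : ℝ} {F : Set X} (h : Metric.ediam F ≤ ENNReal.ofReal r) :
    coverNumber r F ≤ 1 := by
  simpa using coverNumber_le (𝒰 := {F}) (by simpa using h) (by simp)

theorem one_le_coverNumber {F : Set X} (h : F.Nonempty) (r : ℝ) : 1 ≤ coverNumber r F := by
  obtain ⟨𝒰, -, h2, h3⟩ := exists_encard_eq_coverNumber r F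
  obtain ⟨x, hx⟩ := h
  obtain ⟨U, hU, -⟩ := h2 hx
  rw [← h3, one_le_encard_iff_nonempty]
  exact ⟨U, hU⟩

end CoverNumber

/-! ### Comparison of the three dimensions -/

section Dimension

/-- A sequence of scales tending to `0` suffices, since the Hausdorff measure is bounded by the
lower limit of the covering sums, here at most `C`. -/
theorem dimH_le_of_frequently_coverNumber_le {X : Type*} [MetricSpace X] {F : Set X}
    {α : ℝ≥0} {C : ℝ} (h : ∃ᶠ r in 𝓝[>] (0 : ℝ),
      (coverNumber r F : ℝ≥0∞) ≤ ENNReal.ofReal (C * r ^ (-(α : ℝ)))) : dimH F ≤ α := by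
  borelize X
  obtain ⟨r, hr, hp⟩ := exists_seq_forall_of_frequently h
  choose 𝒰 h1 h2 h3 using fun n => exists_encard_eq_coverNumber (r n) F
  have hfin : ∀ n, (𝒰 n).Finite := fun n => by
    rw [← encard_ne_top_iff, h3]
    intro htop
    have := hp n
    rw [htop] at this
    simp at this
  have : ∀ n, Countable (𝒰 n) := fun n => (hfin n).countable
  have hr0 : Tendsto r atTop (𝓝 0) := hr.mono_right nhdsWithin_le_nhds
  have hpos : ∀ᶠ n in atTop, 0 < r n := hr.eventually self_mem_nhdsWithin
  have hle := Measure.hausdorffMeasure_le_liminf_tsum (α : ℝ) F (l := atTop)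
    (fun n => ENNReal.ofReal (r n))
    (ENNReal.ofReal_zero ▸ (ENNReal.continuous_ofReal.tendsto 0).comp hr0)
    (fun n (U : 𝒰 n) => (U : Set X)) (Eventually.of_forall fun n U => h1 n U U.2)
    (Eventually.of_forall fun n x hx => by
      obtain ⟨U, hU, hxU⟩ := h2 n hx
      exact mem_iUnion.2 ⟨⟨U, hU⟩, hxU⟩)
  refine dimH_le_of_hausdorffMeasure_ne_top (ne_top_of_le_ne_top (ENNReal.ofReal_ne_top (r := C))
    (hle.trans ?_))
  refine liminf_le_of_frequently_le' (Eventually.frequently ?_)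
  filter_upwards [hpos] with n hn
  calc ∑' U : 𝒰 n, Metric.ediam (U : Set X) ^ (α : ℝ)
      ≤ ∑' _ : 𝒰 n, ENNReal.ofReal (r n ^ (α : ℝ)) := by
        refine ENNReal.tsum_le_tsum fun U => ?_
        rw [← ENNReal.ofReal_rpow_of_pos hn]
        exact ENNReal.rpow_le_rpow (h1 n U U.2) α.coe_nonneg
    _ = (coverNumber (r n) F : ℝ≥0∞) * ENNReal.ofReal (r n ^ (α : ℝ)) := by
        rw [ENNReal.tsum_const, ← h3]
        rfl
    _ ≤ ENNReal.ofReal (C * r n ^ (-(α : ℝ))) * ENNReal.ofReal (r n ^ (α : ℝ)) := by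
        gcongr; exact hp n
    _ = ENNReal.ofReal C := by
        rw [← ENNReal.ofReal_mul' (by positivity), mul_assoc, ← Real.rpow_add hn]
        simp

/-- Fix `R` as the largest admissible radius, `R ^ (1 + δ) = |F|`. Finitely many balls of radius `R`
cover `F`, so the local bound at this one `R` becomes a global bound of order `r ^ (-α)`. -/
theorem dimH_le_gapAssouadDim {X : Type*} [MetricSpace X] {F : Set X} (hF : TotallyBounded F)
    (hdiam : 0 < Metric.diam F) {δ : ℝ} (hδ : 0 < δ) : dimH F ≤ gapAssouadDim δ F := by
  refine le_iInf₂ fun α ⟨C, hC, h⟩ => ?_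
  set R : ℝ := Metric.diam F ^ (1 + δ)⁻¹
  have hR : 0 < R := Real.rpow_pos_of_pos hdiam _
  have hRδ : R ^ (1 + δ) = Metric.diam F := Real.rpow_inv_rpow hdiam.le (by linarith)
  obtain ⟨t, htF, htfin, ht⟩ := Metric.finite_approx_of_totallyBounded hF R hR
  lift t to Finset X using htfin
  refine dimH_le_of_frequently_coverNumber_le (C := t.card * (C * R ^ (α : ℝ)))
    (Eventually.frequently ?_)
  filter_upwards [Ioc_mem_nhdsGT hdiam] with r hr
  have hloc := h r R hr.1 hR (by rw [hRδ]; exact hr.2) hRδ.le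
  have h1 : coverNumber r F ≤ ∑ x ∈ t, coverNumber r (Metric.ball x R ∩ F) := by
    refine (coverNumber_mono (fun y hy => ?_) r).trans (coverNumber_biUnion_le t _ r)
    obtain ⟨x, hx, hyx⟩ := mem_iUnion₂.1 (ht hy)
    exact mem_iUnion₂.2 ⟨x, hx, hyx, hy⟩
  have h2 : coverNumber r F ≤ t.card * localCoverNumber r R F := by
    refine h1.trans ?_
    rw [← nsmul_eq_mul]
    refine Finset.sum_le_card_nsmul _ _ _ fun x hx => ?_
    exact le_iSup₂ (f := fun x (_ : x ∈ F) => coverNumber r (Metric.ball x R ∩ F)) x (htF hx)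
  calc (coverNumber r F : ℝ≥0∞) ≤ ((t.card * localCoverNumber r R F : ℕ∞) : ℝ≥0∞) := by
        exact_mod_cast h2
    _ ≤ t.card * ENNReal.ofReal (C * (R / r) ^ (α : ℝ)) := by
        push_cast
        gcongr
    _ = _ := by
        rw [← ENNReal.ofReal_natCast, ← ENNReal.ofReal_mul (by positivity),
          Real.div_rpow hR.le hr.1.le, Real.rpow_neg hr.1.le]
        congr 1
        ring

theorem gapAssouadDim_le {X : Type*} [PseudoMetricSpace X] {F : Set X} {δ : ℝ} {s : ℝ≥0}
    (h : ∀ α : ℝ≥0, s < α → ∃ C : ℝ, 0 < C ∧ ∀ r R : ℝ, 0 < r → 0 < R → r ≤ R ^ (1 + δ) →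
      R ^ (1 + δ) ≤ Metric.diam F →
      (localCoverNumber r R F : ℝ≥0∞) ≤ ENNReal.ofReal (C * (R / r) ^ (α : ℝ))) :
    gapAssouadDim δ F ≤ s := by
  refine ENNReal.le_of_forall_pos_le_add fun ε hε _ => ?_
  have := iInf₂_le (f := fun (α : ℝ≥0) (_ : ∃ C : ℝ, 0 < C ∧ ∀ r R : ℝ, 0 < r → 0 < R →
      r ≤ R ^ (1 + δ) → R ^ (1 + δ) ≤ Metric.diam F →
      (localCoverNumber r R F : ℝ≥0∞) ≤ ENNReal.ofReal (C * (R / r) ^ (α : ℝ))) => (α : ℝ≥0∞))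
    (s + ε) (h _ (lt_add_of_pos_right s hε))
  simpa [gapAssouadDim] using this

/-- The covering bounds control the upper limit. A box ratio that is frequently at most some `a < s`
would force `dimH F ≤ a`, which controls the lower limit. -/
theorem hasBoxDim_of_coverNumber_le {X : Type*} [MetricSpace X] {F : Set X} (hF : F.Nonempty)
    {s : ℝ≥0} (hdim : s ≤ dimH F) (h : ∀ t : ℝ≥0, s < t → ∃ C : ℝ, 0 < C ∧ ∀ r : ℝ, 0 < r → r < 1 →
      (coverNumber r F : ℝ≥0∞) ≤ ENNReal.ofReal (C * r ^ (-(t : ℝ)))) : HasBoxDim F s := by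
  -- Any exponent above `s` would do: the bound only shows that the covering numbers are finite, so
  -- that `toNat` in `boxRatio` loses nothing.
  obtain ⟨C₀, hC₀, hfin⟩ := h (s + 1) (by simp)
  have hN : ∀ r : ℝ, 0 < r → r < 1 → ((coverNumber r F).toNat : ℕ∞) = coverNumber r F := by
    intro r h0 h1
    refine ENat.natCast_toNat fun htop => ?_
    have := hfin r h0 h1
    rw [htop] at this
    simp at this
  have hN1 : ∀ r : ℝ, 0 < r → r < 1 → 1 ≤ ((coverNumber r F).toNat : ℝ) := by
    intro r h0 h1
    have := one_le_coverNumber hF r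
    rw [← hN r h0 h1] at this
    exact_mod_cast this
  have hlog : Tendsto (fun r : ℝ => Real.log (1 / r)) (𝓝[>] 0) atTop := by
    refine (tendsto_neg_atBot_atTop.comp Real.tendsto_log_nhdsGT_zero).congr fun r => ?_
    rw [one_div, Real.log_inv, Function.comp_apply]
  have hsmall : ∀ᶠ r : ℝ in 𝓝[>] 0, 0 < r ∧ r < 1 := Ioo_mem_nhdsGT one_pos
  refine tendsto_order.2 ⟨fun a ha => ?_, fun a ha => ?_⟩
  · by_contra hcon
    have hfr : ∃ᶠ r in 𝓝[>] (0 : ℝ), boxRatio r F ≤ a :=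
      (not_eventually.1 hcon).mono fun r => not_lt.1
    lift a to ℝ≥0 using ne_top_of_lt ha
    refine absurd (hdim.trans (dimH_le_of_frequently_coverNumber_le (C := 1) (α := a) ?_))
      (not_le.2 ha)
    refine (hfr.and_eventually hsmall).mono fun r ⟨hr, h0, h1⟩ => ?_
    have hlr : 0 < Real.log (1 / r) := Real.log_pos (by rw [lt_div_iff₀ h0]; linarith)
    have hN1' := hN1 r h0 h1
    rw [boxRatio, ENNReal.ofReal_le_iff_le_toReal ENNReal.coe_ne_top, ENNReal.coe_toReal,
      div_le_iff₀ hlr] at hr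
    have h3 : ((coverNumber r F).toNat : ℝ) ≤ 1 * r ^ (-(a : ℝ)) := by
      rw [one_mul, Real.rpow_def_of_pos h0, ← Real.log_le_iff_le_exp (by linarith)]
      refine hr.trans (le_of_eq ?_)
      rw [one_div, Real.log_inv]; ring
    calc (coverNumber r F : ℝ≥0∞) = ENNReal.ofReal ((coverNumber r F).toNat : ℝ) := by
          rw [ENNReal.ofReal_natCast]
          conv_lhs => rw [← hN r h0 h1]
          rfl
      _ ≤ _ := ENNReal.ofReal_le_ofReal h3
  · obtain ⟨t, hst, hta⟩ := ENNReal.lt_iff_exists_nnreal_btwn.1 ha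
    obtain ⟨u, hsu, hut⟩ := exists_between (ENNReal.coe_lt_coe.1 hst)
    obtain ⟨C, hC, hcov⟩ := h u hsu
    have hut' : (0 : ℝ) < t - u := sub_pos.2 (by exact_mod_cast hut)
    filter_upwards [hsmall, hlog.eventually_ge_atTop (Real.log C / (t - u))] with r ⟨h0, h1⟩ hr
    refine lt_of_le_of_lt ?_ hta
    have hlr : 0 < Real.log (1 / r) := Real.log_pos (by rw [lt_div_iff₀ h0]; linarith)
    rw [boxRatio, ENNReal.ofReal_le_iff_le_toReal ENNReal.coe_ne_top, ENNReal.coe_toReal,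
      div_le_iff₀ hlr]
    have h2 := hcov r h0 h1
    rw [← hN r h0 h1, ENat.toENNReal_coe, ← ENNReal.ofReal_natCast,
      ENNReal.ofReal_le_ofReal_iff (by positivity)] at h2
    have h3 := Real.log_le_log (by linarith [hN1 r h0 h1]) h2
    rw [Real.log_mul hC.ne' (by positivity), Real.log_rpow h0] at h3
    rw [div_le_iff₀ hut'] at hr
    have h4 : Real.log (1 / r) = -Real.log r := by rw [one_div, Real.log_inv]
    rw [h4] at hr ⊢
    nlinarith

end Dimension

/-- The union bound for independent events. It bounds the survival probability of the root by the
weighted sum over its children. -/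
theorem one_sub_sum_le_prod {ι : Type*} (s : Finset ι) (x : ι → ℝ)
    (hx : ∀ i ∈ s, x i ∈ Icc (0 : ℝ) 1) : 1 - ∑ i ∈ s, x i ≤ ∏ i ∈ s, (1 - x i) := by
  classical
  induction s using Finset.induction_on with
  | empty => simp
  | insert i s hi ih =>
    rw [Finset.sum_insert hi, Finset.prod_insert hi]
    have hs : ∀ j ∈ s, x j ∈ Icc (0 : ℝ) 1 := fun j hj => hx j (Finset.mem_insert_of_mem hj)
    have h1 : ∏ j ∈ s, (1 - x j) ≤ 1 :=
      Finset.prod_le_one (fun j hj => by linarith [(hs j hj).2]) fun j hj => by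
        linarith [(hs j hj).1]
    nlinarith [ih hs, (hx i (Finset.mem_insert_self i s)).1]

/-! ### Cut sets of small weight do not block percolation -/

section Cut

variable {L : Type*} {B : ℕ}

/-- The product of the weights `a l j` along the path from the root to `v`. -/
def pathWeight (a : L → Fin B → ℝ) : List (Fin B) → (List (Fin B) → L) → ℝ
  | [], _ => 1
  | j :: v, τ => a (τ []) j * pathWeight a v (childTree j τ)

/-- The first `k` vertices of a ray. -/
def rayPrefix (x : ℕ → Fin B) : ℕ → List (Fin B)
  | 0 => []
  | k + 1 => x 0 :: rayPrefix (fun n => x (n + 1)) k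

theorem pathWeight_nonneg {a : L → Fin B → ℝ} (ha : ∀ l j, 0 ≤ a l j) (v : List (Fin B))
    (τ : List (Fin B) → L) : 0 ≤ pathWeight a v τ := by
  induction v generalizing τ with
  | nil => exact zero_le_one
  | cons j v ih => exact mul_nonneg (ha _ _) (ih _)

theorem pathWeight_rpow {c : L → Fin B → ℝ} (hc : ∀ l j, 0 ≤ c l j) (t : ℝ) (v : List (Fin B))
    (τ : List (Fin B) → L) :
    pathWeight (fun l j => c l j ^ t) v τ = pathWeight c v τ ^ t := by
  induction v generalizing τ with
  | nil => simp [pathWeight]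
  | cons j v ih => simp only [pathWeight, ih, Real.mul_rpow (hc _ _) (pathWeight_nonneg hc _ _)]

/-- The total weight of the vertices in `P`. -/
def cutWeight (a : L → Fin B → ℝ) (P : Set (List (Fin B))) (τ : List (Fin B) → L) : ℝ≥0∞ :=
  ∑' v, P.indicator (fun v => ENNReal.ofReal (pathWeight a v τ)) v

variable {a : L → Fin B → ℝ}

/-- The root alone has weight `1`, so it cannot be in `P`. The cut weights of the children,
multiplied by their edge weights, sum to at most the cut weight of the root, while the survival
probability is subadditive; so the strict inequality descends to some child. -/
theorem exists_child_cutWeight_lt (ha : ∀ l j, a l j ∈ Icc (0 : ℝ) 1) {P : Set (List (Fin B))}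
    {τ : List (Fin B) → L} (h : cutWeight a P τ < ENNReal.ofReal (1 - extinctionLimit a τ)) :
    ([] ∉ P) ∧ ∃ j, 0 < a (τ []) j ∧ cutWeight a {w | j :: w ∈ P} (childTree j τ) <
      ENNReal.ofReal (1 - extinctionLimit a (childTree j τ)) := by
  constructor
  · intro hmem
    refine absurd h (not_lt.2 ?_)
    calc ENNReal.ofReal (1 - extinctionLimit a τ) ≤ 1 := by
          rw [← ENNReal.ofReal_one]
          exact ENNReal.ofReal_le_ofReal (by linarith [(extinctionLimit_mem ha τ).1])
      _ = P.indicator (fun v => ENNReal.ofReal (pathWeight a v τ)) [] := by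
          simp [indicator_of_mem hmem, pathWeight]
      _ ≤ cutWeight a P τ := ENNReal.le_tsum _
  · by_contra! hcon
    refine absurd h (not_lt.2 ?_)
    have hchild : ∀ j w, P.indicator (fun v => ENNReal.ofReal (pathWeight a v τ)) (j :: w) =
        ENNReal.ofReal (a (τ []) j) * {w | j :: w ∈ P}.indicator
          (fun v => ENNReal.ofReal (pathWeight a v (childTree j τ))) w := by
      intro j w
      by_cases hw : j :: w ∈ P
      · rw [indicator_of_mem hw, indicator_of_mem (s := {w | j :: w ∈ P}) hw,
          ← ENNReal.ofReal_mul (ha _ _).1]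
        rfl
      · rw [indicator_of_notMem hw, indicator_of_notMem (s := {w | j :: w ∈ P}) hw, mul_zero]
    calc ENNReal.ofReal (1 - extinctionLimit a τ)
        ≤ ENNReal.ofReal (∑ j, a (τ []) j * (1 - extinctionLimit a (childTree j τ))) := by
          refine ENNReal.ofReal_le_ofReal ?_
          have hterm : ∀ j, a (τ []) j * (1 - extinctionLimit a (childTree j τ)) ∈ Icc (0 : ℝ) 1 :=
            fun j => by
              obtain ⟨h1, h2⟩ := ha (τ []) j
              obtain ⟨h3, h4⟩ := extinctionLimit_mem ha (childTree j τ)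
              constructor <;> nlinarith
          have := one_sub_sum_le_prod Finset.univ _ fun j _ => hterm j
          rw [← extinctionLimit_eq ha τ] at this
          linarith
      _ = ∑ j, ENNReal.ofReal (a (τ []) j) *
            ENNReal.ofReal (1 - extinctionLimit a (childTree j τ)) := by
          rw [ENNReal.ofReal_sum_of_nonneg fun j _ => mul_nonneg (ha _ _).1
            (by linarith [(extinctionLimit_mem ha (childTree j τ)).2])]
          exact Finset.sum_congr rfl fun j _ => ENNReal.ofReal_mul (ha _ _).1
      _ ≤ ∑ j, ENNReal.ofReal (a (τ []) j) *
            cutWeight a {w | j :: w ∈ P} (childTree j τ) := by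
          refine Finset.sum_le_sum fun j _ => ?_
          rcases (ha (τ []) j).1.eq_or_lt with h0 | h0
          · simp [← h0]
          · gcongr; exact hcon j h0
      _ = ∑' p : Fin B × List (Fin B),
            P.indicator (fun v => ENNReal.ofReal (pathWeight a v τ)) (p.1 :: p.2) := by
          rw [ENNReal.tsum_prod (f := fun j w =>
            P.indicator (fun v => ENNReal.ofReal (pathWeight a v τ)) (j :: w)), tsum_fintype]
          refine Finset.sum_congr rfl fun j _ => ?_
          rw [cutWeight, ← ENNReal.tsum_mul_left]
          exact tsum_congr fun w => (hchild j w).symm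
      _ ≤ cutWeight a P τ := by
          refine ENNReal.tsum_comp_le_tsum_of_injective
            (f := fun p : Fin B × List (Fin B) => p.1 :: p.2) ?_ _
          rintro ⟨i, v⟩ ⟨j, w⟩ hvw
          simpa using hvw

/-- A set of vertices whose total weight is smaller than the probability that the percolation
cluster of the root is infinite does not separate the root from infinity. -/
theorem exists_ray_avoiding (ha : ∀ l j, a l j ∈ Icc (0 : ℝ) 1) {P : Set (List (Fin B))}
    {τ : List (Fin B) → L} (h : cutWeight a P τ < ENNReal.ofReal (1 - extinctionLimit a τ)) :
    ∃ x : ℕ → Fin B, ∀ k, 0 < pathWeight a (rayPrefix x k) τ ∧ rayPrefix x k ∉ P := by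
  -- The states are pairs of a tree and a cut set that satisfy the strict inequality; iterating
  -- `next` from `(τ, P)` reads off the ray.
  let T := {p : (List (Fin B) → L) × Set (List (Fin B)) //
    cutWeight a p.2 p.1 < ENNReal.ofReal (1 - extinctionLimit a p.1)}
  choose hnil j hj hlt using fun p : T => exists_child_cutWeight_lt ha p.2
  let next : T → T := fun p => ⟨(childTree (j p) p.1.1, {w | j p :: w ∈ p.1.2}), hlt p⟩
  have key : ∀ k, ∀ p : T, 0 < pathWeight a (rayPrefix (fun n => j (next^[n] p)) k) p.1.1 ∧
      rayPrefix (fun n => j (next^[n] p)) k ∉ p.1.2 := by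
    intro k
    induction k with
    | zero => exact fun p => ⟨zero_lt_one, hnil p⟩
    | succ k ih => exact fun p => ⟨mul_pos (hj p) (ih (next p)).1, (ih (next p)).2⟩
  exact ⟨_, fun k => key k ⟨(τ, P), h⟩⟩

end Cut

/-! ### Similarities and volume packing -/

section Packing

variable {E : Type*} [NormedAddCommGroup E] [NormedSpace ℝ E] [FiniteDimensional ℝ E]

/-- After rescaling, the map is an isometry into a strictly convex space, hence affine; its linear
part is injective, so surjective in finite dimension. -/
theorem surjective_of_dist_eq_mul [StrictConvexSpace ℝ E] {f : E → E} {c : ℝ} (hc : 0 < c)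
    (hf : ∀ x y, dist (f x) (f y) = c * dist x y) : Function.Surjective f := by
  have hiso : Isometry fun x => c⁻¹ • f x := Isometry.of_dist_eq fun x y => by
    rw [dist_smul₀, hf, Real.norm_of_nonneg (inv_nonneg.2 hc.le), ← mul_assoc,
      inv_mul_cancel₀ hc.ne', one_mul]
  let g := hiso.affineIsometryOfStrictConvexSpace
  have hlin : Function.Surjective g.linear :=
    LinearMap.injective_iff_surjective.1 g.linearIsometry.injective
  have hg : Function.Surjective g := g.toAffineMap.linear_surjective_iff.1 hlin
  intro y
  obtain ⟨x, hx⟩ := hg (c⁻¹ • y)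
  exact ⟨x, smul_right_injective E (inv_ne_zero hc.ne') hx⟩

theorem ball_subset_image_ball [StrictConvexSpace ℝ E] {f : E → E} {c : ℝ} (hc : 0 < c)
    (hf : ∀ x y, dist (f x) (f y) = c * dist x y) (z : E) (r : ℝ) :
    Metric.ball (f z) (c * r) ⊆ f '' Metric.ball z r := by
  intro y hy
  obtain ⟨x, rfl⟩ := surjective_of_dist_eq_mul hc hf y
  rw [Metric.mem_ball, hf] at hy
  exact ⟨x, lt_of_mul_lt_mul_left hy hc.le, rfl⟩

/-- Compare Haar measures: disjoint balls inside a larger ball have total volume at most its volume.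
-/
theorem card_mul_pow_le_of_disjoint_balls {ι : Type*} (s : Finset ι) (z : ι → E) {r R : ℝ} {y : E}
    (hr : 0 < r) (hR : 0 < R)
    (hd : (s : Set ι).PairwiseDisjoint fun i => Metric.ball (z i) r)
    (hsub : ∀ i ∈ s, Metric.ball (z i) r ⊆ Metric.ball y R) :
    (s.card : ℝ) * r ^ Module.finrank ℝ E ≤ R ^ Module.finrank ℝ E := by
  borelize E
  let μ : Measure E := Measure.addHaar
  have h1 : μ (⋃ i ∈ s, Metric.ball (z i) r) ≤ μ (Metric.ball y R) :=
    measure_mono (iUnion₂_subset hsub)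
  rw [measure_biUnion_finset hd fun i _ => measurableSet_ball] at h1
  simp only [Measure.addHaar_ball_of_pos μ _ hr, Measure.addHaar_ball_of_pos μ _ hR,
    Finset.sum_const, nsmul_eq_mul] at h1
  rw [← mul_assoc] at h1
  have hpos : μ (Metric.ball 0 1) ≠ 0 := (Metric.measure_ball_pos μ _ one_pos).ne'
  have hfin : μ (Metric.ball 0 1) ≠ ∞ := measure_ball_lt_top.ne
  rw [ENNReal.mul_le_mul_iff_left hpos hfin, ← ENNReal.ofReal_natCast,
    ← ENNReal.ofReal_mul (Nat.cast_nonneg _), ENNReal.ofReal_le_ofReal_iff (by positivity)] at h1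
  exact h1

end Packing

/-! ### Cylinders, stopped vertices and the open set condition -/

section Tree

variable {L : Type*} {B : ℕ} {E : Type*}

/-- The composition of the maps along the path from the root to a vertex. -/
def nodeMap (f : L → Fin B → E → E) : List (Fin B) → (List (Fin B) → L) → E → E
  | [], _ => id
  | j :: v, τ => f (τ []) j ∘ nodeMap f v (childTree j τ)

/-- The vertex is the first one on its path whose path weight is at most `ρ`. -/
def IsStopped (c : L → Fin B → ℝ) : List (Fin B) → ℝ → (List (Fin B) → L) → Prop
  | [], ρ, _ => 1 ≤ ρ
  | j :: v, ρ, τ => ρ < 1 ∧ 0 < c (τ []) j ∧ IsStopped c v (ρ / c (τ []) j) (childTree j τ)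

/-- The `n`-th approximation of the random recursive set. -/
def levelSet (f : L → Fin B → E → E) (c : L → Fin B → ℝ) (Δ : Set E) :
    ℕ → (List (Fin B) → L) → Set E
  | 0, _ => Δ
  | n + 1, τ => ⋃ (j) (_ : 0 < c (τ []) j), f (τ []) j '' levelSet f c Δ n (childTree j τ)

/-- The maps `f l j` with `c l j ≠ 0` are similarities with ratio `c l j`, and these ratios lie
between `cmin` and `cmax`. -/
structure IsSimilaritySystem [PseudoMetricSpace E] (f : L → Fin B → E → E) (c : L → Fin B → ℝ)
    (cmin cmax : ℝ) : Prop where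
  cmin_pos : 0 < cmin
  cmin_le_cmax : cmin ≤ cmax
  cmax_lt_one : cmax < 1
  nonneg : ∀ l j, 0 ≤ c l j
  cmin_le : ∀ l j, 0 < c l j → cmin ≤ c l j
  le_cmax : ∀ l j, c l j ≤ cmax
  dist_eq : ∀ l j, 0 < c l j → ∀ x y, dist (f l j x) (f l j y) = c l j * dist x y

namespace IsSimilaritySystem

variable [PseudoMetricSpace E] {f : L → Fin B → E → E} {c : L → Fin B → ℝ} {cmin cmax : ℝ}
  (h : IsSimilaritySystem f c cmin cmax)

include h

theorem rpow_mem_Icc {t : ℝ} (ht : 0 < t) (l : L) (j : Fin B) : c l j ^ t ∈ Icc (0 : ℝ) 1 :=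
  ⟨Real.rpow_nonneg (h.nonneg l j) t,
    Real.rpow_le_one (h.nonneg l j) ((h.le_cmax l j).trans h.cmax_lt_one.le) ht.le⟩

end IsSimilaritySystem

end Tree

section Tree

variable {L : Type*} {B : ℕ} {E : Type*}

theorem nodeMap_image_subset {f : L → Fin B → E → E} {c : L → Fin B → ℝ} (hc : ∀ l j, 0 ≤ c l j)
    {O : Set E} (hO : ∀ l j, 0 < c l j → f l j '' O ⊆ O) (v : List (Fin B))
    (τ : List (Fin B) → L) (hv : 0 < pathWeight c v τ) : nodeMap f v τ '' O ⊆ O := by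
  induction v generalizing τ with
  | nil => simp [nodeMap]
  | cons j v ih =>
    have hj : 0 < c (τ []) j := pos_of_mul_pos_left hv (pathWeight_nonneg hc v _)
    have hv' := pos_of_mul_pos_right hv (hc (τ []) j)
    rw [nodeMap, image_comp]
    exact (image_mono (ih _ hv')).trans (hO _ _ hj)

theorem levelSet_subset {f : L → Fin B → E → E} {c : L → Fin B → ℝ} {Δ : Set E}
    (hΔ : ∀ l j, 0 < c l j → f l j '' Δ ⊆ Δ) (n : ℕ) (τ : List (Fin B) → L) :
    levelSet f c Δ n τ ⊆ Δ := by
  induction n generalizing τ with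
  | zero => exact Subset.rfl
  | succ n ih =>
    exact iUnion₂_subset fun j hj => (image_mono (ih _)).trans (hΔ _ _ hj)

theorem nodeMap_image_subset_levelSet {f : L → Fin B → E → E} {c : L → Fin B → ℝ}
    (hc : ∀ l j, 0 ≤ c l j) (Δ : Set E) (v : List (Fin B)) (τ : List (Fin B) → L)
    (hv : 0 < pathWeight c v τ) : nodeMap f v τ '' Δ ⊆ levelSet f c Δ v.length τ := by
  induction v generalizing τ with
  | nil => simp [nodeMap, levelSet]
  | cons j v ih =>
    have hj : 0 < c (τ []) j := pos_of_mul_pos_left hv (pathWeight_nonneg hc v _)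
    have hv' := pos_of_mul_pos_right hv (hc (τ []) j)
    rw [nodeMap, image_comp]
    exact (image_mono (ih _ hv')).trans (subset_iUnion₂_of_subset j hj Subset.rfl)

@[simp]
theorem length_rayPrefix (x : ℕ → Fin B) (k : ℕ) : (rayPrefix x k).length = k := by
  induction k generalizing x with
  | zero => rfl
  | succ k ih => simp [rayPrefix, ih]

theorem nodeMap_rayPrefix_succ_subset {f : L → Fin B → E → E} {c : L → Fin B → ℝ}
    (hc : ∀ l j, 0 ≤ c l j) {Δ : Set E} (hΔ : ∀ l j, 0 < c l j → f l j '' Δ ⊆ Δ) (k : ℕ)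
    (x : ℕ → Fin B) (τ : List (Fin B) → L) (hx : 0 < pathWeight c (rayPrefix x (k + 1)) τ) :
    nodeMap f (rayPrefix x (k + 1)) τ '' Δ ⊆ nodeMap f (rayPrefix x k) τ '' Δ := by
  induction k generalizing x τ with
  | zero => simpa [rayPrefix, nodeMap] using nodeMap_image_subset hc hΔ _ τ hx
  | succ k ih =>
    have e : ∀ w, nodeMap f (x 0 :: w) τ '' Δ =
        f (τ []) (x 0) '' (nodeMap f w (childTree (x 0) τ) '' Δ) := fun w => by
      rw [nodeMap, image_comp]
    exact (e _).subset.trans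
      ((image_mono (ih _ _ (pos_of_mul_pos_right hx (hc _ _)))).trans (e _).superset)

/-- Every point of a deep approximation belongs to a cylinder of a stopped vertex. -/
theorem exists_isStopped_of_mem_levelSet {f : L → Fin B → E → E} {c : L → Fin B → ℝ} {cmax : ℝ}
    (hcmax : ∀ l j, c l j ≤ cmax) (hcmax0 : 0 ≤ cmax) (Δ : Set E) (m : ℕ) (τ : List (Fin B) → L)
    (ρ : ℝ) (hρ : cmax ^ m ≤ ρ) {x : E} (hx : x ∈ levelSet f c Δ m τ) :
    ∃ v, IsStopped c v ρ τ ∧ v.length ≤ m ∧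
      x ∈ nodeMap f v τ '' levelSet f c Δ (m - v.length) (descendantTree v τ) := by
  induction m generalizing τ ρ x with
  | zero => exact ⟨[], by simpa [IsStopped] using hρ, le_rfl, x, hx, rfl⟩
  | succ m ih =>
    rcases le_or_gt 1 ρ with h1 | h1
    · exact ⟨[], h1, Nat.zero_le _, x, hx, rfl⟩
    · obtain ⟨j, hj, y, hy, rfl⟩ := mem_iUnion₂.1 hx
      -- Passing to a child divides the threshold by the edge ratio. Since that ratio is at most
      -- `cmax`, one level less still suffices.
      obtain ⟨v, h2, h3, z, hz, rfl⟩ := ih (childTree j τ) (ρ / c (τ []) j) (by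
        rw [le_div_iff₀ hj]
        refine le_trans ?_ hρ
        rw [pow_succ]
        exact mul_le_mul_of_nonneg_left (hcmax _ _) (pow_nonneg hcmax0 m)) hy
      refine ⟨j :: v, ⟨h1, hj, h2⟩, by simpa using h3, z, ?_, rfl⟩
      rw [List.length_cons, Nat.add_sub_add_right]
      exact hz

/-- Every ray passes through a stopped vertex. -/
theorem exists_isStopped_rayPrefix {c : L → Fin B → ℝ} {cmax : ℝ} (hc : ∀ l j, 0 ≤ c l j)
    (hcmax : ∀ l j, c l j ≤ cmax) (hcmax0 : 0 ≤ cmax) (m : ℕ) (x : ℕ → Fin B)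
    (τ : List (Fin B) → L) (ρ : ℝ) (hρ : cmax ^ m ≤ ρ)
    (hx : ∀ k, 0 < pathWeight c (rayPrefix x k) τ) : ∃ k, IsStopped c (rayPrefix x k) ρ τ := by
  induction m generalizing x τ ρ with
  | zero => exact ⟨0, by simpa [IsStopped, rayPrefix] using hρ⟩
  | succ m ih =>
    rcases le_or_gt 1 ρ with h1 | h1
    · exact ⟨0, h1⟩
    · have hj : 0 < c (τ []) (x 0) := by simpa [rayPrefix, pathWeight] using hx 1
      obtain ⟨k, hk⟩ := ih (fun n => x (n + 1)) (childTree (x 0) τ) (ρ / c (τ []) (x 0)) (by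
        rw [le_div_iff₀ hj]
        refine le_trans ?_ hρ
        rw [pow_succ]
        exact mul_le_mul_of_nonneg_left (hcmax _ _) (pow_nonneg hcmax0 m))
        fun k => pos_of_mul_pos_right (hx (k + 1)) (hc _ _)
      exact ⟨k + 1, h1, hj, hk⟩

theorem IsStopped.pathWeight_pos {c : L → Fin B → ℝ} {v : List (Fin B)} {ρ : ℝ}
    {τ : List (Fin B) → L} (h : IsStopped c v ρ τ) : 0 < pathWeight c v τ := by
  induction v generalizing ρ τ with
  | nil => exact zero_lt_one
  | cons j v ih => exact mul_pos h.2.1 (ih h.2.2)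

theorem IsStopped.pathWeight_le {c : L → Fin B → ℝ} {v : List (Fin B)} {ρ : ℝ}
    {τ : List (Fin B) → L} (h : IsStopped c v ρ τ) : pathWeight c v τ ≤ ρ := by
  induction v generalizing ρ τ with
  | nil => exact h
  | cons j v ih =>
    have := ih h.2.2
    rwa [le_div_iff₀ h.2.1, mul_comm] at this

/-- Before its last edge the path still has weight above `ρ`, and that edge costs at most a factor
`cmin`. The assumption `cmin * ρ ≤ 1` covers the root, where `ρ` may exceed `1`. -/
theorem IsStopped.mul_le_pathWeight {c : L → Fin B → ℝ} {cmin : ℝ} (hcmin : 0 < cmin)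
    (hc : ∀ l j, 0 < c l j → cmin ≤ c l j) {v : List (Fin B)} {ρ : ℝ}
    {τ : List (Fin B) → L} (h : IsStopped c v ρ τ) (hρ : cmin * ρ ≤ 1) :
    cmin * ρ ≤ pathWeight c v τ := by
  induction v generalizing ρ τ with
  | nil => exact hρ
  | cons j v ih =>
    obtain ⟨h1, h2, h3⟩ := h
    have := ih h3 (by
      rw [← mul_div_assoc, div_le_one h2]
      exact (mul_le_of_le_one_right hcmin.le h1.le).trans (hc _ _ h2))
    rwa [← mul_div_assoc, div_le_iff₀ h2, mul_comm (pathWeight c v _)] at this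

theorem pathWeight_le_pow {c : L → Fin B → ℝ} {cmax : ℝ} (hc : ∀ l j, 0 ≤ c l j)
    (hcmax : ∀ l j, c l j ≤ cmax) (hcmax0 : 0 ≤ cmax) (v : List (Fin B)) (τ : List (Fin B) → L) :
    pathWeight c v τ ≤ cmax ^ v.length := by
  induction v generalizing τ with
  | nil => simp [pathWeight]
  | cons j v ih =>
    rw [pathWeight, List.length_cons, pow_succ']
    exact mul_le_mul (hcmax _ _) (ih _) (pathWeight_nonneg hc v _) hcmax0

namespace IsSimilaritySystem

section PseudoMetric

variable [PseudoMetricSpace E] {f : L → Fin B → E → E} {c : L → Fin B → ℝ} {cmin cmax : ℝ}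
  (h : IsSimilaritySystem f c cmin cmax)

include h

theorem cmax_pos : 0 < cmax := h.cmin_pos.trans_le h.cmin_le_cmax

theorem dist_nodeMap (v : List (Fin B)) (τ : List (Fin B) → L) (hv : 0 < pathWeight c v τ)
    (x y : E) : dist (nodeMap f v τ x) (nodeMap f v τ y) = pathWeight c v τ * dist x y := by
  induction v generalizing τ with
  | nil => simp [nodeMap, pathWeight]
  | cons j v ih =>
    have hj : 0 < c (τ []) j := pos_of_mul_pos_left hv (pathWeight_nonneg h.nonneg v _)
    rw [nodeMap, Function.comp_apply, Function.comp_apply, h.dist_eq _ _ hj,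
      ih _ (pos_of_mul_pos_right hv (h.nonneg _ _)), pathWeight, mul_assoc]

/-- Each cylinder stopped at `ρ < 1` has `t`-weight at least `(cmin * ρ) ^ t`, so the total weight
bounds the number of these cylinders. The induction carries this out by rescaling each child to the
threshold `ρ / c`. -/
theorem coverNumber_levelSet_le {Δ : Set E} (hΔ : ∀ l j, 0 < c l j → f l j '' Δ ⊆ Δ) {D : ℝ}
    (hD : Metric.ediam Δ ≤ ENNReal.ofReal D) (hD0 : 0 ≤ D) {t : ℝ} (ht : 0 < t) (n : ℕ)
    (τ : List (Fin B) → L) (ρ : ℝ) (hρ : cmax ^ n ≤ ρ) :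
    (coverNumber (ρ * D) (levelSet f c Δ n τ) : ℝ≥0∞) ≤
      ENNReal.ofReal (branchSum (fun l j => c l j ^ t) n τ * max 1 (1 / (cmin * ρ)) ^ t) := by
  have hpos : ∀ l j, 0 ≤ c l j ^ t := fun l j => (h.rpow_mem_Icc ht l j).1
  -- For `ρ ≥ 1` a single set suffices, and the `max 1` keeps the right-hand side at least `1`.
  have hbig : ∀ (n : ℕ) (τ : List (Fin B) → L) (ρ : ℝ), 1 ≤ ρ →
      (coverNumber (ρ * D) (levelSet f c Δ n τ) : ℝ≥0∞) ≤
      ENNReal.ofReal (branchSum (fun l j => c l j ^ t) n τ * max 1 (1 / (cmin * ρ)) ^ t) := by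
    intro n τ ρ h1
    have hle : coverNumber (ρ * D) (levelSet f c Δ n τ) ≤ 1 := coverNumber_le_one <|
      (Metric.ediam_mono (levelSet_subset hΔ n τ)).trans <| hD.trans <|
        ENNReal.ofReal_le_ofReal (le_mul_of_one_le_left hD0 h1)
    calc (coverNumber (ρ * D) (levelSet f c Δ n τ) : ℝ≥0∞) ≤ ENNReal.ofReal 1 := by
          rw [ENNReal.ofReal_one]; exact_mod_cast hle
      _ ≤ _ := by
          refine ENNReal.ofReal_le_ofReal ?_
          exact one_le_mul_of_one_le_of_one_le (one_le_branchSum hpos n τ)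
            (Real.one_le_rpow (le_max_left _ _) ht.le)
  induction n generalizing τ ρ with
  | zero => exact hbig 0 τ ρ (by simpa using hρ)
  | succ n ih =>
    rcases le_or_gt 1 ρ with h1 | h1
    · exact hbig (n + 1) τ ρ h1
    have hρ0 : 0 < ρ := (pow_pos h.cmax_pos _).trans_le hρ
    have hchild : ∀ j, (coverNumber (ρ * D) (⋃ _ : 0 < c (τ []) j,
        f (τ []) j '' levelSet f c Δ n (childTree j τ)) : ℝ≥0∞) ≤
        ENNReal.ofReal (c (τ []) j ^ t * branchSum (fun l j => c l j ^ t) n (childTree j τ) *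
          (1 / (cmin * ρ)) ^ t) := by
      intro j
      rcases (h.nonneg (τ []) j).eq_or_lt with h0 | h0
      · have : coverNumber (ρ * D) (∅ : Set E) ≤ 0 := by
          simpa using coverNumber_le (X := E) (F := ∅) (𝒰 := ∅) (r := ρ * D) (by simp) (by simp)
        simp [← h0, nonpos_iff_eq_zero.1 this]
      · simp only [h0, iUnion_true]
        have hcov := coverNumber_image_le h0 (fun x y => (h.dist_eq _ _ h0 x y).le) (ρ * D)
          (levelSet f c Δ n (childTree j τ))
        have hih := ih (childTree j τ) (ρ / c (τ []) j) (by
          rw [le_div_iff₀ h0]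
          refine le_trans ?_ hρ
          rw [pow_succ]
          exact mul_le_mul_of_nonneg_left (h.le_cmax _ _) (pow_nonneg h.cmax_pos.le n))
        rw [div_mul_eq_mul_div] at hih
        refine le_trans (by exact_mod_cast hcov) (hih.trans (ENNReal.ofReal_le_ofReal
          (le_of_eq ?_)))
        -- For a child the maximum is inactive, since `ρ < 1` and the ratio is at least `cmin`. Thus
        -- the factor `c ^ t` of the branching sum comes out exactly.
        have hmax : max 1 (1 / (cmin * (ρ / c (τ []) j))) = c (τ []) j * (1 / (cmin * ρ)) := by
          have : 1 / (cmin * (ρ / c (τ []) j)) = c (τ []) j * (1 / (cmin * ρ)) := by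
            have := h.cmin_pos.ne'
            field_simp
          rw [this]
          refine max_eq_right ?_
          rw [mul_one_div, le_div_iff₀ (mul_pos h.cmin_pos hρ0), one_mul]
          exact (mul_le_of_le_one_right h.cmin_pos.le h1.le).trans (h.cmin_le _ _ h0)
        rw [hmax, Real.mul_rpow h0.le (by have := h.cmin_pos; positivity)]
        ring
    have hunion : coverNumber (ρ * D) (levelSet f c Δ (n + 1) τ) ≤
        ∑ j, coverNumber (ρ * D) (⋃ _ : 0 < c (τ []) j,
          f (τ []) j '' levelSet f c Δ n (childTree j τ)) := by
      have := coverNumber_biUnion_le Finset.univ (fun j => ⋃ _ : 0 < c (τ []) j,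
          f (τ []) j '' levelSet f c Δ n (childTree j τ)) (ρ * D)
      simpa [levelSet] using this
    calc (coverNumber (ρ * D) (levelSet f c Δ (n + 1) τ) : ℝ≥0∞)
        ≤ ∑ j, (coverNumber (ρ * D) (⋃ _ : 0 < c (τ []) j,
          f (τ []) j '' levelSet f c Δ n (childTree j τ)) : ℝ≥0∞) := by
          exact (ENat.toENNReal_mono hunion).trans_eq (map_sum ENat.toENNRealRingHom _ _)
      _ ≤ ∑ j, ENNReal.ofReal (c (τ []) j ^ t *
            branchSum (fun l j => c l j ^ t) n (childTree j τ) * (1 / (cmin * ρ)) ^ t) :=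
          Finset.sum_le_sum fun j _ => hchild j
      _ = ENNReal.ofReal ((∑ j, c (τ []) j ^ t *
            branchSum (fun l j => c l j ^ t) n (childTree j τ)) * (1 / (cmin * ρ)) ^ t) := by
          rw [Finset.sum_mul, ENNReal.ofReal_sum_of_nonneg]
          intro j _
          have := one_le_branchSum hpos n (childTree j τ)
          have := h.cmin_pos
          have := hpos (τ []) j
          positivity
      _ ≤ _ := by
          have h2 := one_le_branchSum hpos (n + 1) τ
          refine ENNReal.ofReal_le_ofReal (mul_le_mul ?_ ?_ ?_ (by linarith))
          · simp [branchSum]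
          · have := h.cmin_pos
            exact Real.rpow_le_rpow (by positivity) (le_max_right _ _) ht.le
          · have := h.cmin_pos
            positivity

end PseudoMetric

variable [NormedAddCommGroup E] {f : L → Fin B → E → E} {c : L → Fin B → ℝ} {cmin cmax : ℝ}
  (h : IsSimilaritySystem f c cmin cmax)

include h

theorem injective {l : L} {j : Fin B} (hj : 0 < c l j) : Function.Injective (f l j) := by
  intro x y hxy
  have := h.dist_eq l j hj x y
  rw [hxy, dist_self, eq_comm, mul_eq_zero] at this
  exact dist_eq_zero.1 (this.resolve_left hj.ne')

/-- The cylinders of different stopped vertices are disjoint. -/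
theorem disjoint_of_isStopped {O : Set E} (hO : ∀ l j, 0 < c l j → f l j '' O ⊆ O)
    (hdisj : ∀ l i j, 0 < c l i → 0 < c l j → i ≠ j → Disjoint (f l i '' O) (f l j '' O))
    {v w : List (Fin B)} {ρ : ℝ} {τ : List (Fin B) → L} (hv : IsStopped c v ρ τ)
    (hw : IsStopped c w ρ τ) (hvw : v ≠ w) :
    Disjoint (nodeMap f v τ '' O) (nodeMap f w τ '' O) := by
  induction v generalizing w ρ τ with
  | nil =>
    cases w with
    | nil => exact absurd rfl hvw
    | cons i w => exact absurd hw.1 (not_lt.2 hv)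
  | cons j v ih =>
    cases w with
    | nil => exact absurd hv.1 (not_lt.2 hw)
    | cons i w =>
      rw [nodeMap, nodeMap, image_comp, image_comp]
      rcases eq_or_ne j i with rfl | hne
      · exact (disjoint_image_iff (h.injective hv.2.1)).2
          (ih hv.2.2 hw.2.2 fun e => hvw (by rw [e]))
      · exact (hdisj _ j i hv.2.1 hw.2.1 hne).mono
          (image_mono (nodeMap_image_subset h.nonneg hO _ _ hv.2.2.pathWeight_pos))
          (image_mono (nodeMap_image_subset h.nonneg hO _ _ hw.2.2.pathWeight_pos))

/-- Under the open set condition, the number of stopped cylinders of size about `ρ` that meet a ball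
of radius `A * ρ` is bounded. -/
theorem exists_encard_isStopped_le [NormedSpace ℝ E] [StrictConvexSpace ℝ E]
    [FiniteDimensional ℝ E] {O : Set E} (hOo : IsOpen O) (hOn : O.Nonempty)
    (hO : ∀ l j, 0 < c l j → f l j '' O ⊆ O)
    (hdisj : ∀ l i j, 0 < c l i → 0 < c l j → i ≠ j → Disjoint (f l i '' O) (f l j '' O))
    {Δ : Set E} (hΔ : Bornology.IsBounded Δ) {A : ℝ} (hA : 0 ≤ A) :
    ∃ M : ℕ, ∀ (τ : List (Fin B) → L) (ρ : ℝ) (y : E), 0 < ρ → cmin * ρ ≤ 1 →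
      {v | IsStopped c v ρ τ ∧
        (nodeMap f v τ '' Δ ∩ Metric.closedBall y (A * ρ)).Nonempty}.encard ≤ M := by
  obtain ⟨z, hz⟩ := hOn
  obtain ⟨a, ha, hball⟩ := Metric.isOpen_iff.1 hOo z hz
  obtain ⟨D, hD0, hD⟩ : ∃ D, 0 < D ∧ Δ ⊆ Metric.closedBall z D := by
    obtain ⟨D, hD⟩ := hΔ.subset_closedBall z
    exact ⟨max D 1, by positivity, hD.trans (Metric.closedBall_subset_closedBall (le_max_left _ _))⟩
  have hcmin := h.cmin_pos
  -- The volume ratio of a ball of radius `(A + D + a) * ρ` about `y`, which contains all the small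
  -- balls, to one of radius `cmin * ρ * a`, which fits into the image of `O` under each stopped
  -- cylinder map.
  set Q : ℝ := ((A + D + a) / (cmin * a)) ^ Module.finrank ℝ E
  refine ⟨⌊Q⌋₊, fun τ ρ y hρ hρ1 => ?_⟩
  by_contra! hcon
  -- A finite subfamily with one element too many suffices for the volume argument, so finiteness
  -- need not be known beforehand.
  obtain ⟨s, hs, hcard⟩ := exists_subset_encard_eq (Order.add_one_le_of_lt hcon)
  have hsfin : s.Finite := by
    rw [← encard_ne_top_iff, hcard]
    exact_mod_cast ENat.natCast_ne_top (⌊Q⌋₊ + 1)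
  lift s to Finset (List (Fin B)) using hsfin
  rw [encard_coe_eq_coe_finsetCard] at hcard
  have hcard' : s.card = ⌊Q⌋₊ + 1 := by exact_mod_cast hcard
  have hsub : ∀ v ∈ s, Metric.ball (nodeMap f v τ z) (cmin * ρ * a) ⊆ nodeMap f v τ '' O := by
    intro v hv
    have hst := (hs hv).1
    refine (Metric.ball_subset_ball ?_).trans ((ball_subset_image_ball hst.pathWeight_pos
      (h.dist_nodeMap v τ hst.pathWeight_pos) z a).trans (image_mono hball))
    exact mul_le_mul_of_nonneg_right (hst.mul_le_pathWeight hcmin h.cmin_le hρ1) ha.le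
  have hmain := card_mul_pow_le_of_disjoint_balls s (fun v => nodeMap f v τ z)
    (r := cmin * ρ * a) (R := (A + D + a) * ρ) (y := y) (by positivity) (by positivity)
    (fun v hv w hw hvw => (h.disjoint_of_isStopped hO hdisj (hs hv).1 (hs hw).1 hvw).mono
      (hsub v hv) (hsub w hw))
    (fun v hv => by
      obtain ⟨hst, _, ⟨p, hp, rfl⟩, hpy⟩ := hs hv
      refine Metric.ball_subset_ball' ?_
      have h1 : dist (nodeMap f v τ z) (nodeMap f v τ p) ≤ ρ * D := by
        rw [h.dist_nodeMap v τ hst.pathWeight_pos]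
        have := Metric.mem_closedBall.1 (hD hp)
        rw [dist_comm] at this
        exact mul_le_mul hst.pathWeight_le this dist_nonneg hρ.le
      have h2 := dist_triangle (nodeMap f v τ z) (nodeMap f v τ p) y
      have h3 := Metric.mem_closedBall.1 hpy
      have h4 : cmin * ρ * a ≤ ρ * a := by
        have : cmin ≤ 1 := h.cmin_le_cmax.trans h.cmax_lt_one.le
        have := mul_le_mul_of_nonneg_right this (mul_pos hρ ha).le
        linarith
      nlinarith)
  have hQ : (s.card : ℝ) ≤ Q := by
    have : (A + D + a) * ρ = (A + D + a) / (cmin * a) * (cmin * ρ * a) := by field_simp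
    rw [this, mul_pow ((A + D + a) / (cmin * a))] at hmain
    exact le_of_mul_le_mul_right hmain (by positivity)
  have := Nat.lt_floor_add_one Q
  rw [hcard'] at hQ
  push_cast at hQ
  linarith

end IsSimilaritySystem

end Tree

/-- From `x ≤ cmax ^ n` the level `n` is at most a constant times `log (1 / x)`, and `log (1 / x) ≤
x ^ (-η) / η`. So linear growth in the level costs only a small power of the scale. -/
theorem branchSum_bound_le_rpow {C K cmax η x : ℝ} (hC : 0 ≤ C) (hK : 0 ≤ K) (hcmax : 0 < cmax)
    (hcmax1 : cmax < 1) (hη : 0 < η) (hx0 : 0 < x) (hx1 : x ≤ 1) {n : ℕ} (hn : x ≤ cmax ^ n) :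
    C + K * n ≤ (C + K / (η * -Real.log cmax)) * x ^ (-η) := by
  have hl : 0 < -Real.log cmax := by linarith [Real.log_neg hcmax hcmax1]
  have h1 : (n : ℝ) * -Real.log cmax ≤ x ^ (-η) / η := by
    have h2 := Real.log_le_log hx0 hn
    rw [Real.log_pow] at h2
    have h3 := Real.log_le_rpow_div (inv_nonneg.2 hx0.le) hη
    rw [Real.log_inv, Real.inv_rpow hx0.le, ← Real.rpow_neg hx0.le] at h3
    linarith
  have h2 : 1 ≤ x ^ (-η) := Real.one_le_rpow_of_pos_of_le_one_of_nonpos hx0 hx1 (by linarith)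
  have h3 : (n : ℝ) ≤ x ^ (-η) / (η * -Real.log cmax) := by
    rw [le_div_iff₀ hη] at h1
    rw [le_div_iff₀ (by positivity)]
    linarith
  calc C + K * n ≤ C * x ^ (-η) + K * (x ^ (-η) / (η * -Real.log cmax)) := by
        gcongr
        exact le_mul_of_one_le_right hC h2
    _ = _ := by ring

/-! ### Upper bounds for local covering numbers -/

namespace IsSimilaritySystem

variable {L : Type*} {B : ℕ} {E : Type*} [NormedAddCommGroup E] [NormedSpace ℝ E]
  [StrictConvexSpace ℝ E] [FiniteDimensional ℝ E]
  {f : L → Fin B → E → E} {c : L → Fin B → ℝ} {cmin cmax : ℝ}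
  (h : IsSimilaritySystem f c cmin cmax)

include h

/-- A bound for the local covering numbers at a scale `ρ ≤ 1`, in terms of the branching sums of the
subtrees. -/
theorem exists_coverNumber_inter_ball_le {O : Set E} (hOo : IsOpen O) (hOn : O.Nonempty)
    (hO : ∀ l j, 0 < c l j → f l j '' O ⊆ O)
    (hdisj : ∀ l i j, 0 < c l i → 0 < c l j → i ≠ j → Disjoint (f l i '' O) (f l j '' O))
    {Δ : Set E} (hΔb : Bornology.IsBounded Δ) (hΔ : ∀ l j, 0 < c l j → f l j '' Δ ⊆ Δ)
    {t : ℝ} (ht : 0 < t) {C K : ℝ} (hC : 0 ≤ C) (hK : 0 ≤ K) {τ : List (Fin B) → L}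
    (hτ : ∀ v n, branchSum (fun l j => c l j ^ t) n (descendantTree v τ) ≤ C + K * (v.length : ℝ))
    {A η : ℝ} (hA : 0 ≤ A) (hη : 0 < η) :
    ∃ Q D : ℝ, 0 < Q ∧ 0 < D ∧ ∀ ρ r : ℝ, ∀ y : E, 0 < r → 0 < ρ → ρ ≤ 1 →
      (coverNumber r (Metric.closedBall y (A * ρ) ∩ ⋂ n, levelSet f c Δ n τ) : ℝ≥0∞) ≤
        ENNReal.ofReal (Q * ρ ^ (-η) * max 1 (D * ρ / r) ^ t) := by
  obtain ⟨M, hM⟩ := h.exists_encard_isStopped_le hOo hOn hO hdisj hΔb hA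
  obtain ⟨D, hD0, hD⟩ : ∃ D : ℝ, 0 < D ∧ Metric.ediam Δ ≤ ENNReal.ofReal D := by
    refine ⟨Metric.diam Δ + 1, by have := Metric.diam_nonneg (s := Δ); linarith, ?_⟩
    rw [← ENNReal.ofReal_toReal hΔb.ediam_ne_top]
    exact ENNReal.ofReal_le_ofReal (by simp [Metric.diam])
  have hcmin := h.cmin_pos
  have hcmax := h.cmax_pos
  have hlog : 0 < -Real.log cmax := by linarith [Real.log_neg hcmax h.cmax_lt_one]
  set Q : ℝ := M * ((C + K / (η * -Real.log cmax)) * cmin ^ (-η)) with hQ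
  have hQ0 : 0 ≤ Q := by positivity
  refine ⟨Q + 1, D / cmin, by linarith, by positivity, fun ρ r y hr hρ hρ1 => ?_⟩
  have hcρ : cmin * ρ ≤ 1 :=
    mul_le_one₀ (h.cmin_le_cmax.trans h.cmax_lt_one.le) hρ.le hρ1
  -- Level `m` is past both scales: paths are stopped at `ρ` by then, and cylinders of level `m`
  -- have diameter at most `r`.
  obtain ⟨m, hm⟩ := exists_pow_lt_of_lt_one (lt_min hρ (div_pos hr hD0)) h.cmax_lt_one
  have hmρ : cmax ^ m ≤ ρ := hm.le.trans (min_le_left _ _)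
  have hmr : cmax ^ m ≤ r / D := hm.le.trans (min_le_right _ _)
  set V := {v | IsStopped c v ρ τ ∧
        (nodeMap f v τ '' Δ ∩ Metric.closedBall y (A * ρ)).Nonempty} with hV
  have hcard := hM τ ρ y hρ hcρ
  rw [← hV] at hcard
  have hVfin : V.Finite := encard_ne_top_iff.1 (ne_top_of_le_ne_top (ENat.natCast_ne_top M) hcard)
  set s := hVfin.toFinset with hs
  have hscard : (s.card : ℝ) ≤ M := by
    rw [hVfin.encard_eq_coe_toFinset_card] at hcard
    exact_mod_cast hcard
  -- The restriction to length at most `m` makes the subtraction `m - v.length` an honest one.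
  let s' := s.filter fun v => v.length ≤ m
  have hs'card : (s'.card : ℝ) ≤ M :=
    (by exact_mod_cast Finset.card_filter_le _ _ : (s'.card : ℝ) ≤ s.card).trans hscard
  have hsub : Metric.closedBall y (A * ρ) ∩ ⋂ n, levelSet f c Δ n τ ⊆
      ⋃ v ∈ s', nodeMap f v τ '' levelSet f c Δ (m - v.length) (descendantTree v τ) := by
    rintro x ⟨hxy, hxF⟩
    obtain ⟨v, hv1, hv2, hv3⟩ := exists_isStopped_of_mem_levelSet h.le_cmax hcmax.le Δ m τ ρ hmρ
      (mem_iInter.1 hxF m)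
    refine mem_iUnion₂.2 ⟨v, ?_, hv3⟩
    refine Finset.mem_filter.2 ⟨hVfin.mem_toFinset.2 ⟨hv1, x, ?_, hxy⟩, hv2⟩
    exact image_mono (levelSet_subset hΔ _ _) hv3
  have hpiece : ∀ v ∈ s', (coverNumber r (nodeMap f v τ ''
      levelSet f c Δ (m - v.length) (descendantTree v τ)) : ℝ≥0∞) ≤
      ENNReal.ofReal ((C + K / (η * -Real.log cmax)) * cmin ^ (-η) * ρ ^ (-η) *
        max 1 (D / cmin * ρ / r) ^ t) := by
    intro v hv
    obtain ⟨hv1, hvm⟩ := Finset.mem_filter.1 hv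
    have hst := (hVfin.mem_toFinset.1 hv1).1
    set w := pathWeight c v τ
    have hw : 0 < w := hst.pathWeight_pos
    have hwle := pathWeight_le_pow h.nonneg h.le_cmax hcmax.le v τ
    have h1 := coverNumber_image_le hw (fun x y => (h.dist_nodeMap v τ hw x y).le) r
      (levelSet f c Δ (m - v.length) (descendantTree v τ))
    -- Pulling back by a similarity of ratio `w` turns radius `r` into `r / w`, which is `D` times
    -- the threshold `r / w / D`.
    have h2 := h.coverNumber_levelSet_le hΔ hD hD0.le ht (m - v.length) (descendantTree v τ)
      (r / w / D) (by
        rw [div_right_comm, le_div_iff₀ hw]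
        refine le_trans ?_ hmr
        calc cmax ^ (m - v.length) * w ≤ cmax ^ (m - v.length) * cmax ^ v.length := by gcongr
          _ = cmax ^ m := by rw [← pow_add, Nat.sub_add_cancel hvm])
    rw [div_mul_cancel₀ _ hD0.ne'] at h2
    refine le_trans (by exact_mod_cast h1) (h2.trans (ENNReal.ofReal_le_ofReal ?_))
    refine mul_le_mul ?_ ?_ (by positivity) (by positivity)
    · refine (hτ v _).trans ?_
      have := branchSum_bound_le_rpow hC hK hcmax h.cmax_lt_one hη (mul_pos hcmin hρ) hcρ
        ((hst.mul_le_pathWeight hcmin h.cmin_le hcρ).trans hwle)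
      rwa [Real.mul_rpow hcmin.le hρ.le, ← mul_assoc] at this
    · refine Real.rpow_le_rpow (by positivity) (max_le_max le_rfl ?_) ht.le
      calc 1 / (cmin * (r / w / D)) = D / cmin * w / r := by field_simp
        _ ≤ D / cmin * ρ / r := by gcongr; exact hst.pathWeight_le
  calc (coverNumber r (Metric.closedBall y (A * ρ) ∩ ⋂ n, levelSet f c Δ n τ) : ℝ≥0∞)
      ≤ ∑ v ∈ s', (coverNumber r (nodeMap f v τ ''
          levelSet f c Δ (m - v.length) (descendantTree v τ)) : ℝ≥0∞) :=
        (ENat.toENNReal_mono ((coverNumber_mono hsub r).trans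
          (coverNumber_biUnion_le s' _ r))).trans_eq (map_sum ENat.toENNRealRingHom _ _)
    _ ≤ s'.card • ENNReal.ofReal ((C + K / (η * -Real.log cmax)) * cmin ^ (-η) * ρ ^ (-η) *
          max 1 (D / cmin * ρ / r) ^ t) := Finset.sum_le_card_nsmul _ _ _ hpiece
    _ = ENNReal.ofReal (s'.card * ((C + K / (η * -Real.log cmax)) * cmin ^ (-η) * ρ ^ (-η) *
          max 1 (D / cmin * ρ / r) ^ t)) := by
        rw [nsmul_eq_mul, ENNReal.ofReal_mul (Nat.cast_nonneg _), ENNReal.ofReal_natCast]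
    _ ≤ ENNReal.ofReal ((Q + 1) * ρ ^ (-η) * max 1 (D / cmin * ρ / r) ^ t) := by
        refine ENNReal.ofReal_le_ofReal ?_
        calc _ ≤ (M : ℝ) * ((C + K / (η * -Real.log cmax)) * cmin ^ (-η) * ρ ^ (-η) *
              max 1 (D / cmin * ρ / r) ^ t) := by gcongr
          _ = Q * ρ ^ (-η) * max 1 (D / cmin * ρ / r) ^ t := by rw [hQ]; ring
          _ ≤ _ := by gcongr; linarith

/-- This is where the gap enters: `r ≤ R ^ (1 + δ)` gives `R ^ (-δ) ≤ R / r`. With `η = δ * (α - t)`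
the loss `R ^ (-η)` is then at most `(R / r) ^ (α - t)`, exactly the room between `t` and `α`. -/
theorem exists_localCoverNumber_le {O : Set E} (hOo : IsOpen O) (hOn : O.Nonempty)
    (hO : ∀ l j, 0 < c l j → f l j '' O ⊆ O)
    (hdisj : ∀ l i j, 0 < c l i → 0 < c l j → i ≠ j → Disjoint (f l i '' O) (f l j '' O))
    {Δ : Set E} (hΔb : Bornology.IsBounded Δ) (hΔ : ∀ l j, 0 < c l j → f l j '' Δ ⊆ Δ)
    {t : ℝ} (ht : 0 < t) {C K : ℝ} (hC : 0 ≤ C) (hK : 0 ≤ K) {τ : List (Fin B) → L}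
    (hτ : ∀ v n, branchSum (fun l j => c l j ^ t) n (descendantTree v τ) ≤ C + K * (v.length : ℝ))
    {α δ A : ℝ} (hα : t < α) (hδ : 0 < δ) (hA : 0 < A) :
    ∃ Q : ℝ, 0 < Q ∧ ∀ r R : ℝ, 0 < r → 0 < R → r ≤ R ^ (1 + δ) → R ≤ A →
      (localCoverNumber r R (⋂ n, levelSet f c Δ n τ) : ℝ≥0∞) ≤
        ENNReal.ofReal (Q * (R / r) ^ α) := by
  have hη : 0 < δ * (α - t) := mul_pos hδ (sub_pos.2 hα)
  obtain ⟨Q, D, hQ, hD, hcov⟩ := h.exists_coverNumber_inter_ball_le hOo hOn hO hdisj hΔb hΔ ht hC hK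
    hτ hA.le hη
  -- The first entry bounds `1` by a multiple of `R / r`, using `R ≤ A`; the second handles `D * (R
  -- / A) / r`.
  set W : ℝ := max (A ^ δ) (D / A)
  have hW : 0 < W := lt_max_of_lt_left (by positivity)
  refine ⟨Q * A ^ (δ * (α - t)) * W ^ t, by positivity, fun r R hr hR hrR hRA => ?_⟩
  have hx : 0 < R / r := div_pos hR hr
  have hRx : R ^ (-δ) ≤ R / r := by
    rw [le_div_iff₀ hr]
    calc R ^ (-δ) * r ≤ R ^ (-δ) * R ^ (1 + δ) := by gcongr
      _ = R := by rw [← Real.rpow_add hR]; simp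
  have hbound : Q * (R / A) ^ (-(δ * (α - t))) * max 1 (D * (R / A) / r) ^ t ≤
      Q * A ^ (δ * (α - t)) * W ^ t * (R / r) ^ α := by
    have h1 : (R / A) ^ (-(δ * (α - t))) ≤ A ^ (δ * (α - t)) * (R / r) ^ (α - t) := by
      rw [Real.div_rpow hR.le hA.le, Real.rpow_neg hA.le, div_inv_eq_mul, mul_comm]
      gcongr
      calc R ^ (-(δ * (α - t))) = (R ^ (-δ)) ^ (α - t) := by
            rw [← Real.rpow_mul hR.le, neg_mul]
        _ ≤ (R / r) ^ (α - t) :=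
            Real.rpow_le_rpow (by positivity) hRx (sub_pos.2 hα).le
    have h2 : max 1 (D * (R / A) / r) ≤ W * (R / r) := by
      refine max_le ?_ ?_
      · calc (1 : ℝ) = R ^ δ * R ^ (-δ) := by rw [← Real.rpow_add hR]; simp
          _ ≤ A ^ δ * (R / r) := by gcongr
          _ ≤ W * (R / r) := by gcongr; exact le_max_left _ _
      · calc D * (R / A) / r = D / A * (R / r) := by field_simp
          _ ≤ W * (R / r) := by gcongr; exact le_max_right _ _
    calc _ ≤ Q * (A ^ (δ * (α - t)) * (R / r) ^ (α - t)) * (W * (R / r)) ^ t := by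
          gcongr
      _ = Q * A ^ (δ * (α - t)) * W ^ t * ((R / r) ^ (α - t) * (R / r) ^ t) := by
          rw [Real.mul_rpow hW.le hx.le]; ring
      _ = _ := by rw [← Real.rpow_add hx, sub_add_cancel]
  have hle : localCoverNumber r R (⋂ n, levelSet f c Δ n τ) ≤
      ⨆ x : E, coverNumber r (Metric.closedBall x (A * (R / A)) ∩ ⋂ n, levelSet f c Δ n τ) := by
    refine iSup₂_le fun x _ => le_iSup_of_le x (coverNumber_mono ?_ r)
    rw [mul_div_cancel₀ _ hA.ne']
    exact inter_subset_inter_left _ Metric.ball_subset_closedBall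
  have hall : ∀ x : E, (coverNumber r (Metric.closedBall x (A * (R / A)) ∩
      ⋂ n, levelSet f c Δ n τ) : ℝ≥0∞) ≤ ENNReal.ofReal (Q * A ^ (δ * (α - t)) * W ^ t *
        (R / r) ^ α) := fun x =>
    (hcov (R / A) r x hr (by positivity) ((div_le_one hA).2 hRA)).trans
      (ENNReal.ofReal_le_ofReal hbound)
  -- The supremum over centres is taken in `ℕ∞`, so the real bound is first rounded down to an
  -- integer.
  obtain ⟨n, hn⟩ : ∃ n : ℕ, n = ⌊Q * A ^ (δ * (α - t)) * W ^ t * (R / r) ^ α⌋₊ := ⟨_, rfl⟩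
  have hpos : 0 ≤ Q * A ^ (δ * (α - t)) * W ^ t * (R / r) ^ α := by positivity
  have hfl : ∀ x : E, coverNumber r (Metric.closedBall x (A * (R / A)) ∩
      ⋂ n, levelSet f c Δ n τ) ≤ n := by
    intro x
    have := hall x
    generalize coverNumber r (Metric.closedBall x (A * (R / A)) ∩
      ⋂ n, levelSet f c Δ n τ) = N at this ⊢
    induction N using ENat.recTopCoe with
    | top => simp at this
    | coe k =>
      rw [ENat.toENNReal_coe, ← ENNReal.ofReal_natCast, ENNReal.ofReal_le_ofReal_iff hpos] at this
      rw [hn]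
      exact_mod_cast Nat.le_floor this
  calc (localCoverNumber r R (⋂ n, levelSet f c Δ n τ) : ℝ≥0∞) ≤ ((n : ℕ∞) : ℝ≥0∞) :=
        ENat.toENNReal_mono (hle.trans (iSup_le hfl))
    _ ≤ _ := by
        rw [ENat.toENNReal_coe, ← ENNReal.ofReal_natCast]
        exact ENNReal.ofReal_le_ofReal (hn ▸ Nat.floor_le hpos)

end IsSimilaritySystem

theorem tsum_indicator_le_of_encard_le {ι : Type*} {V : Set ι} {M : ℕ} (hV : V.encard ≤ M)
    {g : ι → ℝ≥0∞} {b : ℝ≥0∞} (hg : ∀ v ∈ V, g v ≤ b) : ∑' v, V.indicator g v ≤ M * b := by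
  rw [← tsum_subtype]
  calc ∑' v : V, g v ≤ ∑' _ : V, b := ENNReal.tsum_le_tsum fun v => hg v v.2
    _ = (V.encard : ℝ≥0∞) * b := by rw [ENNReal.tsum_const]; rfl
    _ ≤ M * b := by
      gcongr
      exact ENat.toENNReal_mono hV

/-! ### Positivity of the Hausdorff measure -/

namespace IsSimilaritySystem

variable {L : Type*} {B : ℕ} {E : Type*} [NormedAddCommGroup E] [NormedSpace ℝ E]
  [StrictConvexSpace ℝ E] [FiniteDimensional ℝ E]
  {f : L → Fin B → E → E} {c : L → Fin B → ℝ} {cmin cmax : ℝ}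
  (h : IsSimilaritySystem f c cmin cmax)

include h

omit [NormedSpace ℝ E] [StrictConvexSpace ℝ E] [FiniteDimensional ℝ E] in
theorem exists_mem_of_ray {Δ : Set E} (hΔc : IsCompact Δ) (hΔn : Δ.Nonempty)
    (hΔ : ∀ l j, 0 < c l j → f l j '' Δ ⊆ Δ) {τ : List (Fin B) → L} {x : ℕ → Fin B}
    (hx : ∀ k, 0 < pathWeight c (rayPrefix x k) τ) :
    ∃ p ∈ ⋂ n, levelSet f c Δ n τ, ∀ k, p ∈ nodeMap f (rayPrefix x k) τ '' Δ := by
  have hcomp : ∀ k, IsCompact (nodeMap f (rayPrefix x k) τ '' Δ) := fun k => by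
    refine hΔc.image (LipschitzWith.continuous (K := (pathWeight c (rayPrefix x k) τ).toNNReal)
      (LipschitzWith.of_dist_le_mul fun y z => ?_))
    rw [Real.coe_toNNReal _ (hx k).le]
    exact (h.dist_nodeMap _ τ (hx k) y z).le
  obtain ⟨p, hp⟩ := IsCompact.nonempty_iInter_of_sequence_nonempty_isCompact_isClosed
    (fun k => nodeMap f (rayPrefix x k) τ '' Δ)
    (fun k => nodeMap_rayPrefix_succ_subset h.nonneg hΔ k x τ (hx (k + 1)))
    (fun k => hΔn.image _) (hcomp 0) fun k => (hcomp k).isClosed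
  have hp' := mem_iInter.1 hp
  refine ⟨p, mem_iInter.2 fun n => ?_, hp'⟩
  simpa using nodeMap_image_subset_levelSet h.nonneg Δ (rayPrefix x n) τ (hx n) (hp' n)

/-- If the percolation with edge probabilities `c l j ^ t` has an infinite cluster with positive
probability, then the `t`-dimensional Hausdorff measure of the limit set is positive. -/
theorem hausdorffMeasure_ne_zero [MeasurableSpace E] [BorelSpace E] {O : Set E} (hOo : IsOpen O)
    (hOn : O.Nonempty) (hO : ∀ l j, 0 < c l j → f l j '' O ⊆ O)
    (hdisj : ∀ l i j, 0 < c l i → 0 < c l j → i ≠ j → Disjoint (f l i '' O) (f l j '' O))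
    {Δ : Set E} (hΔc : IsCompact Δ) (hΔn : Δ.Nonempty) (hΔ : ∀ l j, 0 < c l j → f l j '' Δ ⊆ Δ)
    {t : ℝ} (ht : 0 < t) {τ : List (Fin B) → L}
    (hτ : extinctionLimit (fun l j => c l j ^ t) τ < 1) :
    Measure.hausdorffMeasure t (⋂ n, levelSet f c Δ n τ) ≠ 0 := by
  intro hzero
  obtain ⟨M, hM⟩ := h.exists_encard_isStopped_le hOo hOn hO hdisj hΔc.isBounded zero_le_one
  set e : ℝ≥0∞ := ENNReal.ofReal (1 - extinctionLimit (fun l j => c l j ^ t) τ) with he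
  have he0 : e ≠ 0 := (ENNReal.ofReal_pos.2 (by linarith)).ne'
  -- One `κ` is for the cover and one for enlarging its radii; the `+ 1` makes `M * (κ + κ) < e`
  -- strict.
  set κ : ℝ≥0∞ := e / (2 * ((M : ℝ≥0∞) + 1)) with hκ
  have hκ0 : κ ≠ 0 := (ENNReal.div_pos he0 (ENNReal.mul_ne_top (by simp) (by simp))).ne'
  have hκe : (M : ℝ≥0∞) * (κ + κ) < e := by
    have hden : 2 * ((M : ℝ≥0∞) + 1) ≠ ∞ := ENNReal.mul_ne_top (by simp) (by simp)
    have h1 : ((M : ℝ≥0∞) + 1) * (κ + κ) = e := by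
      rw [← two_mul, mul_left_comm, ← mul_assoc, hκ]
      exact ENNReal.mul_div_cancel (by simp) hden
    have hκtop : κ ≠ ∞ := ENNReal.div_ne_top ENNReal.ofReal_ne_top (by simp)
    calc (M : ℝ≥0∞) * (κ + κ) < (M : ℝ≥0∞) * (κ + κ) + (κ + κ) :=
          ENNReal.lt_add_right (ENNReal.mul_ne_top (by simp) (by simp [hκtop])) (by simp [hκ0])
      _ = e := by rw [← h1]; ring
  obtain ⟨U, hUcov, hUdiam, hUsum⟩ : ∃ U : ℕ → Set E, (⋂ n, levelSet f c Δ n τ) ⊆ ⋃ n, U n ∧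
      (∀ n, Metric.ediam (U n) ≤ 1) ∧
      ∑' n, ⨆ _ : (U n).Nonempty, Metric.ediam (U n) ^ t < κ := by
    rw [Measure.hausdorffMeasure_apply] at hzero
    have h1 := (le_iSup₂ (f := fun (r : ℝ≥0∞) (_ : 0 < r) =>
      ⨅ (U : ℕ → Set E) (_ : (⋂ n, levelSet f c Δ n τ) ⊆ ⋃ n, U n)
        (_ : ∀ n, Metric.ediam (U n) ≤ r),
        ∑' n, ⨆ _ : (U n).Nonempty, Metric.ediam (U n) ^ t) 1 one_pos).trans hzero.le
    have h2 := lt_of_le_of_lt h1 (pos_iff_ne_zero.2 hκ0)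
    simp only [iInf_lt_iff] at h2
    obtain ⟨U, h3, h4, h5⟩ := h2
    exact ⟨U, h3, h4, h5⟩
  obtain ⟨ε, hε0, hεsum⟩ := ENNReal.exists_pos_sum_of_countable hκ0 ℕ
  -- Covering sets may have diameter `0`, so the radii are made positive at a total cost below `κ`;
  -- the cap `1` keeps the bound by `M` applicable.
  set ρ : ℕ → ℝ := fun n => max (Metric.diam (U n)) (min 1 ((ε n : ℝ) ^ t⁻¹)) with hρdef
  have hρ0 : ∀ n, 0 < ρ n := fun n =>
    lt_max_of_lt_right (lt_min one_pos (Real.rpow_pos_of_pos (hε0 n) _))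
  have hUtop : ∀ n, Metric.ediam (U n) ≠ ∞ := fun n =>
    ne_top_of_le_ne_top ENNReal.one_ne_top (hUdiam n)
  have hρ1 : ∀ n, ρ n ≤ 1 := fun n => by
    refine max_le ?_ (min_le_left _ _)
    simpa [Metric.diam] using ENNReal.toReal_mono ENNReal.one_ne_top (hUdiam n)
  have hρt : ∀ n, ENNReal.ofReal (ρ n ^ t) ≤ Metric.ediam (U n) ^ t + ε n := by
    intro n
    rcases le_total (Metric.diam (U n)) (min 1 ((ε n : ℝ) ^ t⁻¹)) with h1 | h1
    · refine le_add_left ?_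
      rw [← ENNReal.ofReal_coe_nnreal]
      refine ENNReal.ofReal_le_ofReal ?_
      calc ρ n ^ t = min 1 ((ε n : ℝ) ^ t⁻¹) ^ t := by simp only [hρdef, max_eq_right h1]
        _ ≤ ((ε n : ℝ) ^ t⁻¹) ^ t :=
          Real.rpow_le_rpow (by positivity) (min_le_right _ _) ht.le
        _ = ε n := Real.rpow_inv_rpow (ε n).coe_nonneg ht.ne'
    · refine le_add_right (le_of_eq ?_)
      simp only [hρdef, max_eq_left h1]
      rw [← ENNReal.ofReal_rpow_of_nonneg Metric.diam_nonneg ht.le, Metric.diam,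
        ENNReal.ofReal_toReal (hUtop n)]
  -- The cylinders of size about `ρ n` that meet `U n`: at most `M` of them, each of weight at most
  -- `ρ n ^ t`. Their union over `n` is the cut set.
  set V : ℕ → Set (List (Fin B)) := fun n =>
    {v | IsStopped c v (ρ n) τ ∧ (nodeMap f v τ '' Δ ∩ U n).Nonempty} with hVdef
  have hV : ∀ n, ∑' v, (V n).indicator
      (fun v => ENNReal.ofReal (pathWeight (fun l j => c l j ^ t) v τ)) v ≤
      (M : ℝ≥0∞) * ((⨆ _ : (U n).Nonempty, Metric.ediam (U n) ^ t) + ε n) := by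
    intro n
    rcases (U n).eq_empty_or_nonempty with hU | hU
    · have : V n = ∅ := by
        ext v; simp [hVdef, hU]
      simp [this]
    · simp only [hU, iSup_pos]
      obtain ⟨y, hy⟩ := hU
      have hsub : V n ⊆ {v | IsStopped c v (ρ n) τ ∧
          (nodeMap f v τ '' Δ ∩ Metric.closedBall y (1 * ρ n)).Nonempty} := by
        rintro v ⟨h1, z, hz, hzU⟩
        refine ⟨h1, z, hz, ?_⟩
        rw [one_mul, Metric.mem_closedBall]
        exact (Metric.dist_le_diam_of_mem' (hUtop n) hzU hy).trans (le_max_left _ _)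
      have hcr : cmin * ρ n ≤ 1 :=
        mul_le_one₀ (h.cmin_le_cmax.trans h.cmax_lt_one.le) (hρ0 n).le (hρ1 n)
      refine (tsum_indicator_le_of_encard_le ((encard_le_encard hsub).trans
        (hM τ (ρ n) y (hρ0 n) hcr)) (b := ENNReal.ofReal (ρ n ^ t)) fun v hv => ?_).trans ?_
      · rw [pathWeight_rpow h.nonneg]
        exact ENNReal.ofReal_le_ofReal
          (Real.rpow_le_rpow (pathWeight_nonneg h.nonneg _ _) hv.1.pathWeight_le ht.le)
      · gcongr
        exact hρt n
  have hcut : cutWeight (fun l j => c l j ^ t) (⋃ n, V n) τ < e := by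
    refine lt_of_le_of_lt ?_ hκe
    calc cutWeight (fun l j => c l j ^ t) (⋃ n, V n) τ
        ≤ ∑' v, ∑' n, (V n).indicator
            (fun v => ENNReal.ofReal (pathWeight (fun l j => c l j ^ t) v τ)) v := by
          refine ENNReal.tsum_le_tsum fun v => ?_
          by_cases hv : v ∈ ⋃ n, V n
          · obtain ⟨n, hn⟩ := mem_iUnion.1 hv
            rw [indicator_of_mem hv]
            refine le_trans (le_of_eq ?_) (ENNReal.le_tsum n)
            rw [indicator_of_mem hn]
          · rw [indicator_of_notMem hv]; exact zero_le
      _ = ∑' n, ∑' v, (V n).indicator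
            (fun v => ENNReal.ofReal (pathWeight (fun l j => c l j ^ t) v τ)) v :=
          ENNReal.tsum_comm
      _ ≤ ∑' n, (M : ℝ≥0∞) * ((⨆ _ : (U n).Nonempty, Metric.ediam (U n) ^ t) + ε n) :=
          ENNReal.tsum_le_tsum hV
      _ ≤ (M : ℝ≥0∞) * (κ + κ) := by
          rw [ENNReal.tsum_mul_left, ENNReal.tsum_add]
          gcongr
  obtain ⟨x, hx⟩ := exists_ray_avoiding (fun l j => h.rpow_mem_Icc ht l j) hcut
  have hxpos : ∀ k, 0 < pathWeight c (rayPrefix x k) τ := fun k => by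
    have := (hx k).1
    rw [pathWeight_rpow h.nonneg] at this
    refine lt_of_le_of_ne (pathWeight_nonneg h.nonneg _ _) fun h0 => ?_
    rw [← h0, Real.zero_rpow ht.ne'] at this
    exact lt_irrefl _ this
  -- The point `p` of the avoiding ray lies in some `U n`. The vertex where the ray is stopped at `ρ
  -- n` then belongs to `V n`, a contradiction.
  obtain ⟨p, hpF, hp⟩ := h.exists_mem_of_ray hΔc hΔn hΔ hxpos
  obtain ⟨n, hn⟩ := mem_iUnion.1 (hUcov hpF)
  obtain ⟨m, hm⟩ := exists_pow_lt_of_lt_one (hρ0 n) h.cmax_lt_one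
  obtain ⟨k, hk⟩ := exists_isStopped_rayPrefix h.nonneg h.le_cmax h.cmax_pos.le m x τ (ρ n) hm.le
    hxpos
  exact (hx k).2 (mem_iUnion.2 ⟨n, hk, p, hp k, hn⟩)

end IsSimilaritySystem

theorem hasQuasiAssouadDim_empty {X : Type*} [PseudoMetricSpace X] :
    HasQuasiAssouadDim (∅ : Set X) 0 := by
  have h : ∀ δ, gapAssouadDim δ (∅ : Set X) = 0 := fun δ =>
    le_antisymm (gapAssouadDim_le (s := 0) fun α _ => ⟨1, one_pos, by simp [localCoverNumber]⟩)
      zero_le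
  simp only [HasQuasiAssouadDim, h, tendsto_const_nhds]

theorem hasBoxDim_empty {X : Type*} [PseudoMetricSpace X] : HasBoxDim (∅ : Set X) 0 := by
  have h : ∀ r, boxRatio r (∅ : Set X) = 0 := fun r => by
    have : coverNumber r (∅ : Set X) ≤ 0 := by
      simpa using coverNumber_le (X := X) (F := ∅) (𝒰 := ∅) (r := r) (by simp) (by simp)
    simp [boxRatio, nonpos_iff_eq_zero.1 this]
  simp only [HasBoxDim, h, tendsto_const_nhds]

/-- A point of the `n`-th approximation provides a path of `n` edges that are all kept with
probability `1`. Thus a nonempty limit set rules out extinction. -/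
theorem extinctionProb_eq_zero_of_levelSet_nonempty {L : Type*} {B : ℕ} {E : Type*}
    {f : L → Fin B → E → E} {c b : L → Fin B → ℝ} (hb : ∀ l j, 0 < c l j → b l j = 1)
    {Δ : Set E} (n : ℕ) (τ : List (Fin B) → L) (hn : (levelSet f c Δ n τ).Nonempty) :
    extinctionProb b n τ = 0 := by
  induction n generalizing τ with
  | zero => rfl
  | succ n ih =>
    obtain ⟨x, hx⟩ := hn
    obtain ⟨j, hj, y, hy, -⟩ := mem_iUnion₂.1 hx
    refine Finset.prod_eq_zero (Finset.mem_univ j) ?_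
    rw [hb _ _ hj, ih _ ⟨y, hy⟩]
    ring

/-! ### The critical exponent and the almost sure dimension -/

namespace IsSimilaritySystem

variable {L : Type*} {B : ℕ} {E : Type*} [NormedAddCommGroup E]
  {f : L → Fin B → E → E} {c : L → Fin B → ℝ} {cmin cmax : ℝ}

/-- The exponent at which the mean of the sum of the powers of the ratios passes the value `1`. -/
theorem exists_criticalExponent [MeasurableSpace L] (h : IsSimilaritySystem f c cmin cmax)
    (hm : ∀ j, Measurable fun l => c l j)
    (μ : Measure L) [IsProbabilityMeasure μ] {n : L → ℕ} (hn : Measurable n)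
    (hnc : ∀ l, n l = (Finset.univ.filter fun j => 0 < c l j).card)
    (hmean : 1 < ∫ l, (n l : ℝ) ∂μ) :
    ∃ s : ℝ, 0 < s ∧ (∀ t, 0 < t → t < s → 1 < ∫ l, ∑ j, c l j ^ t ∂μ) ∧
      ∀ t, s < t → ∫ l, ∑ j, c l j ^ t ∂μ < 1 := by
  have hcmin := h.cmin_pos
  have hcmax := h.cmax_pos
  have hint : ∀ t : ℝ, 0 < t → Integrable (fun l => ∑ j, c l j ^ t) μ := fun t ht => by
    refine integrable_finsetSum _ fun j _ => ?_
    refine Integrable.of_bound (C := 1) ((hm j).pow_const t).aestronglyMeasurable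
      (Eventually.of_forall fun l => ?_)
    rw [Real.norm_of_nonneg (h.rpow_mem_Icc ht l j).1]
    exact (h.rpow_mem_Icc ht l j).2
  have hnint : Integrable (fun l => (n l : ℝ)) μ := by
    refine Integrable.of_bound (C := B) (by fun_prop) (Eventually.of_forall fun l => ?_)
    rw [Real.norm_of_nonneg (Nat.cast_nonneg _), hnc]
    exact_mod_cast (Finset.card_filter_le _ _).trans (by simp)
  have hanti : ∀ t u : ℝ, 0 < t → t ≤ u → ∫ l, ∑ j, c l j ^ u ∂μ ≤
      cmax ^ (u - t) * ∫ l, ∑ j, c l j ^ t ∂μ := by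
    intro t u ht htu
    rw [← integral_const_mul]
    refine integral_mono (hint u (ht.trans_le htu)) ((hint t ht).const_mul _) fun l => ?_
    simp only [Finset.mul_sum]
    refine Finset.sum_le_sum fun j _ => ?_
    rcases (h.nonneg l j).eq_or_lt with h0 | h0
    · rw [← h0, Real.zero_rpow (ht.trans_le htu).ne', Real.zero_rpow ht.ne', mul_zero]
    · calc c l j ^ u = c l j ^ (u - t) * c l j ^ t := by rw [← Real.rpow_add h0, sub_add_cancel]
        _ ≤ _ := by
          gcongr
          exact h.le_cmax l j
  have hlow : ∀ t : ℝ, 0 < t → cmin ^ t * ∫ l, (n l : ℝ) ∂μ ≤ ∫ l, ∑ j, c l j ^ t ∂μ := by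
    intro t ht
    rw [← integral_const_mul]
    refine integral_mono (hnint.const_mul _) (hint t ht) fun l => ?_
    calc cmin ^ t * (n l : ℝ) = ∑ j ∈ Finset.univ.filter fun j => 0 < c l j, cmin ^ t := by
          rw [Finset.sum_const, hnc, nsmul_eq_mul, mul_comm]
      _ ≤ ∑ j ∈ Finset.univ.filter fun j => 0 < c l j, c l j ^ t :=
          Finset.sum_le_sum fun j hj => Real.rpow_le_rpow hcmin.le
            (h.cmin_le l j (Finset.mem_filter.1 hj).2) ht.le
      _ ≤ ∑ j, c l j ^ t := Finset.sum_le_sum_of_subset_of_nonneg (Finset.filter_subset _ _)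
          fun j _ _ => (h.rpow_mem_Icc ht l j).1
  have hup : ∀ t : ℝ, 0 < t → ∫ l, ∑ j, c l j ^ t ∂μ ≤ B * cmax ^ t := by
    intro t ht
    calc ∫ l, ∑ j, c l j ^ t ∂μ ≤ ∫ _, (B * cmax ^ t : ℝ) ∂μ := by
          refine integral_mono (hint t ht) (integrable_const _) fun l => ?_
          calc ∑ j, c l j ^ t ≤ ∑ _ : Fin B, cmax ^ t := Finset.sum_le_sum fun j _ =>
                Real.rpow_le_rpow (h.nonneg l j) (h.le_cmax l j) ht.le
            _ = B * cmax ^ t := by simp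
      _ = B * cmax ^ t := by simp
  -- The supremum of `T` serves as `s`, without continuity of the mean: `T` is nonempty since the
  -- mean is at least `cmin ^ t` times the mean of `n`, and bounded since it is at most `B * cmax ^
  -- t`. The factor in `hanti` makes the inequality strict above `s`. Only `t > 0` is used, as `0 ^
  -- 0 = 1` would count absent maps.
  set T : Set ℝ := {t | 0 < t ∧ 1 < ∫ l, ∑ j, c l j ^ t ∂μ} with hT
  have hTne : T.Nonempty := by
    have hlim : Tendsto (fun t : ℝ => cmin ^ t * ∫ l, (n l : ℝ) ∂μ) (𝓝[>] 0)
        (𝓝 (1 * ∫ l, (n l : ℝ) ∂μ)) := by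
      refine Tendsto.mul_const _ ?_
      have := (Real.continuous_const_rpow hcmin.ne').tendsto 0
      rw [Real.rpow_zero] at this
      exact this.mono_left nhdsWithin_le_nhds
    rw [one_mul] at hlim
    obtain ⟨t, ht1, ht0⟩ := ((hlim.eventually_const_lt hmean).and self_mem_nhdsWithin).exists
    exact ⟨t, ht0, ht1.trans_le (hlow t ht0)⟩
  have hTb : BddAbove T := by
    have hlim := (tendsto_rpow_atTop_of_base_lt_one cmax (by linarith) h.cmax_lt_one).const_mul
      (B : ℝ)
    rw [mul_zero] at hlim
    obtain ⟨A, hA⟩ := eventually_atTop.1 (hlim.eventually_lt_const one_pos)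
    refine ⟨A, fun t ht => ?_⟩
    by_contra! hcon
    have := hA t hcon.le
    have := hup t ht.1
    linarith [ht.2]
  obtain ⟨t₀, ht₀⟩ := hTne
  have hs0 : 0 < sSup T := ht₀.1.trans_le (le_csSup hTb ht₀)
  refine ⟨sSup T, hs0, fun t ht hts => ?_, fun t hts => ?_⟩
  · obtain ⟨u, hu, htu⟩ := exists_lt_of_lt_csSup ⟨t₀, ht₀⟩ hts
    refine hu.2.trans_le ((hanti t u ht htu.le).trans (mul_le_of_le_one_left ?_ ?_))
    · exact integral_nonneg fun l => Finset.sum_nonneg fun j _ => (h.rpow_mem_Icc ht l j).1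
    · exact Real.rpow_le_one hcmax.le h.cmax_lt_one.le (by linarith)
  · obtain ⟨u, hu, hut⟩ := exists_between hts
    have hu1 : ∫ l, ∑ j, c l j ^ u ∂μ ≤ 1 := by
      by_contra! hcon
      exact absurd (le_csSup hTb ⟨hs0.trans hu, hcon⟩) (not_le.2 hu)
    calc ∫ l, ∑ j, c l j ^ t ∂μ ≤ cmax ^ (t - u) * ∫ l, ∑ j, c l j ^ u ∂μ :=
          hanti u t (hs0.trans hu) hut.le
      _ ≤ cmax ^ (t - u) * 1 := by gcongr
      _ < 1 := by
          rw [mul_one]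
          exact Real.rpow_lt_one hcmax.le h.cmax_lt_one (by linarith)

variable [NormedSpace ℝ E] [StrictConvexSpace ℝ E] [FiniteDimensional ℝ E]

/-- The local bound at scale `ρ = 1`, for a ball that contains `Δ`. -/
theorem exists_coverNumber_le (h : IsSimilaritySystem f c cmin cmax)
    {O : Set E} (hOo : IsOpen O) (hOn : O.Nonempty)
    (hO : ∀ l j, 0 < c l j → f l j '' O ⊆ O)
    (hdisj : ∀ l i j, 0 < c l i → 0 < c l j → i ≠ j → Disjoint (f l i '' O) (f l j '' O))
    {Δ : Set E} (hΔb : Bornology.IsBounded Δ) (hΔ : ∀ l j, 0 < c l j → f l j '' Δ ⊆ Δ)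
    {t : ℝ} (ht : 0 < t) {C K : ℝ} (hC : 0 ≤ C) (hK : 0 ≤ K) {τ : List (Fin B) → L}
    (hτ : ∀ v n, branchSum (fun l j => c l j ^ t) n (descendantTree v τ) ≤
      C + K * (v.length : ℝ)) :
    ∃ Q : ℝ, 0 < Q ∧ ∀ r : ℝ, 0 < r → r < 1 →
      (coverNumber r (⋂ n, levelSet f c Δ n τ) : ℝ≥0∞) ≤ ENNReal.ofReal (Q * r ^ (-t)) := by
  obtain ⟨z, _⟩ := hOn
  obtain ⟨A, hA⟩ := hΔb.subset_closedBall z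
  obtain ⟨Q, D, hQ, hD, hcov⟩ := h.exists_coverNumber_inter_ball_le hOo ⟨z, ‹_›⟩ hO hdisj hΔb hΔ ht
    hC hK hτ (abs_nonneg A) one_pos
  refine ⟨Q * max 1 D ^ t, by positivity, fun r hr hr1 => ?_⟩
  have hsub : (⋂ n, levelSet f c Δ n τ) ⊆
      Metric.closedBall z (|A| * 1) ∩ ⋂ n, levelSet f c Δ n τ := by
    refine subset_inter ((iInter_subset _ 0).trans (hA.trans ?_)) Subset.rfl
    exact Metric.closedBall_subset_closedBall (by simpa using le_abs_self A)
  refine (ENat.toENNReal_mono (coverNumber_mono hsub r)).trans ((hcov 1 r z hr one_pos le_rfl).trans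
    (ENNReal.ofReal_le_ofReal ?_))
  have h1 : max 1 (D * 1 / r) ≤ max 1 D * r⁻¹ := by
    refine max_le ?_ ?_
    · exact one_le_mul_of_one_le_of_one_le (le_max_left _ _) ((one_le_inv₀ hr).2 hr1.le)
    · rw [mul_one, div_eq_mul_inv]
      gcongr
      exact le_max_right _ _
  calc Q * 1 ^ (-1 : ℝ) * max 1 (D * 1 / r) ^ t ≤ Q * (max 1 D * r⁻¹) ^ t := by
        rw [Real.one_rpow, mul_one]
        gcongr
    _ = Q * max 1 D ^ t * r ^ (-t) := by
        rw [Real.mul_rpow (by positivity) (by positivity), Real.inv_rpow hr.le,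
          Real.rpow_neg hr.le, mul_assoc]

/-- For almost every tree, the three dimensions of the limit set agree, and they are equal to the
critical exponent if the limit set is not empty. -/
theorem exists_ae_dimension_eq [MeasurableSpace L] (h : IsSimilaritySystem f c cmin cmax)
    (hm : ∀ j, Measurable fun l => c l j)
    (μ : Measure L) [IsProbabilityMeasure μ] {n : L → ℕ} (hn : Measurable n)
    (hnc : ∀ l, n l = (Finset.univ.filter fun j => 0 < c l j).card)
    (hmean : 1 < ∫ l, (n l : ℝ) ∂μ)
    {O : Set E} (hOo : IsOpen O) (hOn : O.Nonempty)
    (hO : ∀ l j, 0 < c l j → f l j '' O ⊆ O)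
    (hdisj : ∀ l i j, 0 < c l i → 0 < c l j → i ≠ j → Disjoint (f l i '' O) (f l j '' O))
    {Δ : Set E} (hΔc : IsCompact Δ) (hΔn : Δ.Nonempty)
    (hΔ : ∀ l j, 0 < c l j → f l j '' Δ ⊆ Δ) :
    ∃ s : ℝ≥0, ∀ᵐ τ ∂labelLaw μ B,
      HasQuasiAssouadDim (⋂ n, levelSet f c Δ n τ) (dimH (⋂ n, levelSet f c Δ n τ)) ∧
      HasBoxDim (⋂ n, levelSet f c Δ n τ) (dimH (⋂ n, levelSet f c Δ n τ)) ∧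
      ((⋂ n, levelSet f c Δ n τ).Nonempty → dimH (⋂ n, levelSet f c Δ n τ) = s) := by
  borelize E
  obtain ⟨s, hs0, hlow, hup⟩ := h.exists_criticalExponent hm μ hn hnc hmean
  lift s to ℝ≥0 using hs0.le
  -- Sequences tending to `s` from both sides reduce the almost sure statements to countably many
  -- exponents.
  obtain ⟨t, -, ht, htlim⟩ := exists_seq_strictMono_tendsto' hs0
  obtain ⟨u, -, hu, hulim⟩ := exists_seq_strictAnti_tendsto (s : ℝ)
  have hmpow : ∀ a j, Measurable fun l => c l j ^ (a : ℝ) := fun a j => (hm j).pow_const a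
  have hpos : ∀ {a : ℝ}, 0 < a → ∀ l j, 0 < c l j ^ a ↔ 0 < c l j := fun {a} ha l j => by
    refine ⟨fun h1 => lt_of_le_of_ne (h.nonneg l j) fun h0 => ?_, fun h1 => Real.rpow_pos_of_pos h1 a⟩
    rw [← h0, Real.zero_rpow ha.ne'] at h1
    exact lt_irrefl _ h1
  have hA := ae_all_iff.2 fun k => ae_extinctionLimit_lt_one μ
    (h.rpow_mem_Icc (ht k).1) (hmpow (t k)) (hlow (t k) (ht k).1 (ht k).2) hn
    (by simpa only [hpos (ht k).1] using hnc)
  have hB := ae_all_iff.2 fun k => ae_branchSum_descendantTree_le μ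
    (h.rpow_mem_Icc (hs0.trans (hu k))) (hmpow (u k)) (hup (u k) (hu k))
  refine ⟨s, ?_⟩
  filter_upwards [hA, hB] with τ hτA hτB
  set F := ⋂ n, levelSet f c Δ n τ with hF
  rcases F.eq_empty_or_nonempty with hempty | hne
  · rw [hempty, dimH_empty]
    exact ⟨hasQuasiAssouadDim_empty, hasBoxDim_empty, fun hcon => absurd hcon not_nonempty_empty⟩
  have hFΔ : F ⊆ Δ := iInter_subset _ 0
  have hFb : Bornology.IsBounded F := hΔc.isBounded.subset hFΔ
  have hle : (s : ℝ≥0∞) ≤ dimH F := by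
    have hk : ∀ k, ENNReal.ofReal (t k) ≤ dimH F := by
      intro k
      have hlt := hτA k (by
        have h0 : ∀ n, extinctionProb (fun l j => if 0 < c l j ^ t k then (1 : ℝ) else 0) n τ = 0 :=
          fun n => extinctionProb_eq_zero_of_levelSet_nonempty (f := f) (c := c) (Δ := Δ)
            (fun l j hj => if_pos ((hpos (ht k).1 l j).2 hj)) n τ
            (hne.mono (iInter_subset _ n))
        simp [extinctionLimit, h0])
      have := h.hausdorffMeasure_ne_zero hOo hOn hO hdisj hΔc hΔn hΔ (ht k).1 hlt
      rw [← Real.coe_toNNReal _ (ht k).1.le] at this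
      exact le_dimH_of_hausdorffMeasure_ne_zero this
    have hlim : Tendsto (fun k => ENNReal.ofReal (t k)) atTop (𝓝 (ENNReal.ofReal (s : ℝ))) :=
      (ENNReal.continuous_ofReal.tendsto _).comp htlim
    rw [ENNReal.ofReal_coe_nnreal] at hlim
    exact le_of_tendsto' hlim hk
  -- A subsingleton has dimension `0 < s`; so the diameter is positive and admissible radii exist.
  have hdiam : 0 < Metric.diam F := by
    refine Metric.diam_pos ?_ hFb
    by_contra hcon
    rw [dimH_subsingleton (not_nontrivial_iff.1 hcon), nonpos_iff_eq_zero, ENNReal.coe_eq_zero]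
      at hle
    rw [hle] at hs0
    exact lt_irrefl _ hs0
  have hgap : ∀ δ, 0 < δ → gapAssouadDim δ F ≤ s := by
    intro δ hδ
    refine gapAssouadDim_le fun α hα => ?_
    obtain ⟨k, hk⟩ := (hulim.eventually_lt_const (NNReal.coe_lt_coe.2 hα)).exists
    obtain ⟨C, K, hC, hK, hCK⟩ := hτB k
    -- The bound `|F| ^ (1 + δ)⁻¹` is the largest `R` allowed by `R ^ (1 + δ) ≤ |F|`.
    obtain ⟨Q, hQ, hloc⟩ := h.exists_localCoverNumber_le hOo hOn hO hdisj hΔc.isBounded hΔ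
      (hs0.trans (hu k)) hC hK hCK hk hδ (Real.rpow_pos_of_pos hdiam (1 + δ)⁻¹)
    refine ⟨Q, hQ, fun r R hr hR hrR hRF => hloc r R hr hR hrR ?_⟩
    rw [← Real.rpow_rpow_inv hR.le (by linarith : 1 + δ ≠ 0)]
    exact Real.rpow_le_rpow (by positivity) hRF (inv_nonneg.2 (by linarith))
  have hge : ∀ δ, 0 < δ → dimH F ≤ gapAssouadDim δ F := fun δ hδ =>
    dimH_le_gapAssouadDim (hΔc.totallyBounded.subset hFΔ) hdiam hδ
  have hdim : dimH F = s := le_antisymm ((hge 1 one_pos).trans (hgap 1 one_pos)) hle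
  refine ⟨?_, ?_, fun _ => hdim⟩
  · refine tendsto_const_nhds.congr' ?_
    filter_upwards [self_mem_nhdsWithin] with δ hδ
    exact le_antisymm (hge δ hδ) ((hgap δ hδ).trans hle)
  · rw [hdim]
    refine hasBoxDim_of_coverNumber_le hne hle fun α hα => ?_
    obtain ⟨k, hk⟩ := (hulim.eventually_lt_const (NNReal.coe_lt_coe.2 hα)).exists
    obtain ⟨C, K, hC, hK, hCK⟩ := hτB k
    obtain ⟨Q, hQ, hcov⟩ := h.exists_coverNumber_le hOo hOn hO hdisj hΔc.isBounded hΔ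
      (hs0.trans (hu k)) hC hK hCK
    refine ⟨Q, hQ, fun r hr hr1 => (hcov r hr hr1).trans (ENNReal.ofReal_le_ofReal ?_)⟩
    gcongr Q * ?_
    exact Real.rpow_le_rpow_of_exponent_ge hr hr1.le (by linarith)

end IsSimilaritySystem

/-! ### Translation from the random iterated function system -/

namespace RIFS

variable {k d : ℕ} (S : RIFS k d)

/-- The map with index `j` of the system with index `l`, or the identity if there is none. -/
def extendedMap (l : S.Λ) (j : Fin S.bound) :
    EuclideanSpace ℝ (Fin d) → EuclideanSpace ℝ (Fin d) :=
  if h : (j : ℕ) < S.N l then S.f l ⟨j, h⟩ else id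

/-- The factor by which the map with index `j` of the system with index `l` stretches the segment
from `0` to `e`, or `0` if there is no such map. -/
def ratio (e : EuclideanSpace ℝ (Fin d)) (l : S.Λ) (j : Fin S.bound) : ℝ :=
  if h : (j : ℕ) < S.N l then ‖S.f l ⟨j, h⟩ e - S.f l ⟨j, h⟩ 0‖ / ‖e‖ else 0

theorem measurable_ratio (e : EuclideanSpace ℝ (Fin d)) (j : Fin S.bound) :
    Measurable fun l => S.ratio e l j := by
  have hs : MeasurableSet {l | (j : ℕ) < S.N l} := measurableSet_lt measurable_const S.measurable_N
  refine Measurable.dite (s := {l | (j : ℕ) < S.N l})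
    (f := fun l => ‖S.f l.1 ⟨j, l.2⟩ e - S.f l.1 ⟨j, l.2⟩ 0‖ / ‖e‖) (g := fun _ => 0)
    ?_ measurable_const hs
  exact (((S.measurable_f j e).sub (S.measurable_f j 0)).norm).div_const _

variable {S}

/-- The assumption gives each ratio only by an existential statement. Reading it off from the images
of `0` and one fixed vector `e ≠ 0` makes it a measurable function of the label. -/
theorem exists_isSimilaritySystem (hsim : S.UniformSimilarities) {e : EuclideanSpace ℝ (Fin d)}
    (he : e ≠ 0) : (∀ l j, 0 < S.ratio e l j ↔ (j : ℕ) < S.N l) ∧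
      ∃ cmin cmax, IsSimilaritySystem S.extendedMap (S.ratio e) cmin cmax := by
  obtain ⟨cmin, cmax, h0, hle, h1, hc⟩ := hsim
  have he' : 0 < ‖e‖ := norm_pos_iff.2 he
  have key : ∀ l (j : Fin S.bound) (hj : (j : ℕ) < S.N l), cmin ≤ S.ratio e l j ∧
      S.ratio e l j ≤ cmax ∧ ∀ x y, ‖S.f l ⟨j, hj⟩ x - S.f l ⟨j, hj⟩ y‖ =
        S.ratio e l j * ‖x - y‖ := by
    intro l j hj
    obtain ⟨c, hc1, hc2, hc3⟩ := hc l ⟨j, hj⟩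
    have : S.ratio e l j = c := by
      rw [ratio, dif_pos hj, hc3, sub_zero, mul_div_cancel_right₀ _ he'.ne']
    rw [this]
    exact ⟨hc1, hc2, hc3⟩
  have hzero : ∀ l (j : Fin S.bound), ¬ (j : ℕ) < S.N l → S.ratio e l j = 0 := fun l j hj =>
    dif_neg hj
  have hpos : ∀ l j, 0 < S.ratio e l j ↔ (j : ℕ) < S.N l := fun l j =>
    ⟨fun hp => by_contra fun hj => hp.ne' (hzero l j hj), fun hj => h0.trans_le (key l j hj).1⟩
  refine ⟨hpos, cmin, cmax, h0, hle, h1, fun l j => ?_, fun l j hj => ?_, fun l j => ?_,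
    fun l j hj x y => ?_⟩
  · by_cases hj : (j : ℕ) < S.N l
    · exact ((hpos l j).2 hj).le
    · exact (hzero l j hj).ge
  · exact (key l j ((hpos l j).1 hj)).1
  · by_cases hj : (j : ℕ) < S.N l
    · exact (key l j hj).2.1
    · exact (hzero l j hj).trans_le (h0.le.trans hle)
  · have hj' := (hpos l j).1 hj
    rw [extendedMap, dif_pos hj', dist_eq_norm, dist_eq_norm]
    exact (key l j hj').2.2 x y

theorem codingTree_cons_eq_some {τ : S.CodeTree} {j : Fin S.bound} {v : S.Node}
    {w : List S.Letter} : S.codingTree τ (j :: v) = some w ↔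
      ∃ (h : (j : ℕ) < S.N (τ [])) (w' : List S.Letter),
        S.codingTree (childTree j τ) v = some w' ∧ w = ⟨τ [], ⟨j, h⟩⟩ :: w' := by
  change Option.map₂ (fun w w' => w ++ w') (S.letterCoding (τ []) j)
    (S.codingTree (childTree j τ) v) = some w ↔ _
  rw [letterCoding]
  split_ifs with h
  · cases S.codingTree (childTree j τ) v with
    | none => simp
    | some w' => simp [h, eq_comm]
  · simp [h]

theorem biUnion_levelCodings {c : S.Λ → Fin S.bound → ℝ}
    (hc : ∀ l j, 0 < c l j ↔ (j : ℕ) < S.N l) (Δ : Set (EuclideanSpace ℝ (Fin d))) (n : ℕ)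
    (τ : S.CodeTree) :
    ⋃ w ∈ S.levelCodings τ n, S.wordMap w '' Δ = levelSet S.extendedMap c Δ n τ := by
  induction n generalizing τ with
  | zero =>
    have : S.levelCodings τ 0 = {[]} := by
      ext w
      constructor
      · rintro ⟨v, hv, hw⟩
        rw [List.length_eq_zero_iff.1 hv] at hw
        exact (Option.some.inj hw).symm
      · rintro rfl
        exact ⟨[], rfl, rfl⟩
    simp [this, wordMap, levelSet]
  | succ n ih =>
    ext x
    simp only [levelSet, mem_iUnion₂, ← ih]
    constructor
    · rintro ⟨w, ⟨v, hv, hw⟩, hx⟩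
      cases v with
      | nil => simp at hv
      | cons j v =>
        obtain ⟨h, w', hw', rfl⟩ := codingTree_cons_eq_some.1 hw
        rw [wordMap, image_comp] at hx
        refine ⟨j, (hc _ _).2 h, ?_⟩
        rw [extendedMap, dif_pos h]
        exact image_mono (subset_iUnion₂_of_subset w' ⟨v, by simpa using hv, hw'⟩ Subset.rfl) hx
    · rintro ⟨j, hj, y, hy, rfl⟩
      have h := (hc _ _).1 hj
      obtain ⟨w', ⟨v, hv, hw'⟩, z, hz, rfl⟩ := mem_iUnion₂.1 hy
      refine ⟨⟨τ [], ⟨j, h⟩⟩ :: w', ⟨j :: v, by simp [hv], codingTree_cons_eq_some.2 ⟨h, w', hw', rfl⟩⟩,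
        z, hz, ?_⟩
      rw [extendedMap, dif_pos h]
      rfl

theorem randomRecursiveSet_eq {c : S.Λ → Fin S.bound → ℝ}
    (hc : ∀ l j, 0 < c l j ↔ (j : ℕ) < S.N l) {Δ : Set (EuclideanSpace ℝ (Fin d))}
    (hΔ : ∀ l j, 0 < c l j → S.extendedMap l j '' Δ ⊆ Δ) (τ : S.CodeTree) :
    S.randomRecursiveSet Δ τ = ⋂ n, levelSet S.extendedMap c Δ n τ := by
  simp only [randomRecursiveSet, biUnion_levelCodings hc]
  refine Subset.antisymm (subset_iInter fun n => ?_) (subset_iInter₂ fun n _ => iInter_subset _ n)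
  cases n with
  -- The intersection on the right also includes level `0`, which is harmless because level `1` is
  -- already contained in `Δ`.
  | zero => exact (iInter₂_subset 1 le_rfl).trans (levelSet_subset hΔ 1 τ)
  | succ n => exact iInter₂_subset (n + 1) (by omega)

/-- In dimension `0` all images of `O` coincide, so the open set condition allows at most one map
per label, against a mean above `1`. -/
theorem exists_ne_zero (hext : S.NonExtinguishing) (hosc : S.UniformOpenSetCondition) :
    ∃ e : EuclideanSpace ℝ (Fin d), e ≠ 0 := by
  by_contra! hcon
  have hsub : Subsingleton (EuclideanSpace ℝ (Fin d)) := ⟨fun x y => by rw [hcon x, hcon y]⟩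
  obtain ⟨O, -, ⟨z, hz⟩, hO, hdisj⟩ := hosc
  have hN : ∀ l, S.N l ≤ 1 := by
    intro l
    by_contra! h2
    have := hdisj l ⟨0, by omega⟩ ⟨1, h2⟩
      ⟨z, ⟨z, hz, Subsingleton.elim _ _⟩, ⟨z, hz, Subsingleton.elim _ _⟩⟩
    simp at this
  have hm := S.measurable_N
  have hle : ∫ l, (S.N l : ℝ) ∂S.μ ≤ ∫ _, (1 : ℝ) ∂S.μ := by
    refine integral_mono ?_ (integrable_const _) fun l => Nat.cast_le_one.2 (hN l)
    refine Integrable.of_bound (C := 1) (by fun_prop) (Eventually.of_forall fun l => ?_)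
    rw [Real.norm_of_nonneg (Nat.cast_nonneg _)]
    exact Nat.cast_le_one.2 (hN l)
  simp at hle
  exact absurd hext (not_lt.2 hle)

end RIFS

end

theorem mainTheorem1 {k d : ℕ} (S : RIFS k d)
    (hsim : S.UniformSimilarities)
    (hext : S.NonExtinguishing)
    (hosc : S.UniformOpenSetCondition)
    (Δ : Set (EuclideanSpace ℝ (Fin d))) (hΔ : S.IsInvariantCompact Δ) :
    ∃ s : ℝ≥0, ∀ᵐ τ ∂S.treeMeasure,
      HasQuasiAssouadDim (S.randomRecursiveSet Δ τ) (dimH (S.randomRecursiveSet Δ τ)) ∧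
      HasBoxDim (S.randomRecursiveSet Δ τ) (dimH (S.randomRecursiveSet Δ τ)) ∧
      ((S.randomRecursiveSet Δ τ).Nonempty → dimH (S.randomRecursiveSet Δ τ) = s) := by
  obtain ⟨e, he⟩ := RIFS.exists_ne_zero hext hosc
  obtain ⟨hpos, cmin, cmax, hsys⟩ := RIFS.exists_isSimilaritySystem hsim he
  obtain ⟨hΔc, hΔn, hΔi⟩ := hΔ
  obtain ⟨O, hOo, hOn, hO, hdisj⟩ := hosc
  have himage : ∀ A : Set (EuclideanSpace ℝ (Fin d)),
      (∀ (l : S.Λ) (i : Fin (S.N l)), S.f l i '' A ⊆ A) →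
      ∀ l j, 0 < S.ratio e l j → S.extendedMap l j '' A ⊆ A := by
    intro A hA l j hj
    rw [RIFS.extendedMap, dif_pos ((hpos l j).1 hj)]
    exact hA l _
  have hdisj' : ∀ l i j, 0 < S.ratio e l i → 0 < S.ratio e l j → i ≠ j →
      Disjoint (S.extendedMap l i '' O) (S.extendedMap l j '' O) := by
    intro l i j hi hj hij
    rw [RIFS.extendedMap, RIFS.extendedMap, dif_pos ((hpos l i).1 hi), dif_pos ((hpos l j).1 hj),
      Set.disjoint_iff_inter_eq_empty]
    by_contra hne
    have := hdisj l _ _ (nonempty_iff_ne_empty.2 hne)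
    exact hij (Fin.ext (Fin.mk.inj this))
  have hN : ∀ l, S.N l = (Finset.univ.filter fun j => 0 < S.ratio e l j).card := by
    intro l
    simp only [hpos]
    have := Fin.card_filter_val_lt (n := S.bound) (m := S.N l)
    rw [this, min_eq_right (S.N_le l)]
  obtain ⟨s, hs⟩ := hsys.exists_ae_dimension_eq (S.measurable_ratio e) S.μ S.measurable_N hN hext
    hOo hOn (himage O hO) hdisj' hΔc hΔn (himage Δ hΔi)
  refine ⟨s, hs.mono fun τ hτ => ?_⟩
  rwa [RIFS.randomRecursiveSet_eq hpos (himage Δ hΔi)]
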